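/- Let $n>2$ and let $(\mathcal M,\mathbf c,K)$ be a conformal optical geometry of dimension $n+2$: $\mathcal M$ is a smooth $(n+2)$-manifold, $\mathbf c$ is a conformal class $\{e^{2\varphi}g\}$ of smooth metrics of signature $(+,\dots,+,-)$, and $K\subset T\mathcal M$ is a smooth line distribution that is null for $\mathbf c$. An optical vector field is a smooth nowhere vanishing section $k$ of $K$ over an open subset of $\mathcal M$. Suppose that the congruence of curves tangent to $K$ is geodesic and non-shearing: for every optical vector field $k$ and every $g\in\mathbf c$, with $\kappa=g(k,\cdot)$, one has $(\mathcal L_k\kappa)(v)=0$ for all sections $v$ of $K^\perp$, and the shear of $k$, i.e. the trace-free part (with respect to the metric induced by $g$ on $K^\perp/K$) of $\tfrac12(\mathcal L_kg)|_{K^\perp}$, vanishes; equivalently, at each point $\tfrac12(\mathcal L_k g)(v,w)=\rho\, g(v,w)$ for some real $\rho$ and all sections $v,w$ of $K^\perp$. Then, for every optical vector field $k$ and every metric $g\in\mathbf c$, with $\kappa_a=g_{ab}k^b$ and $\tau_{abc}=3\,\kappa_{[a}\nabla_b\kappa_{c]}$, the Weyl tensor of $g$ satisfies, wherever $k$ is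 defined, $$4\,\kappa_{[a}W_{b]ef[c}\kappa_{d]}k^ek^f=\tau_{abe}\,\tau^{e}{}_{cd}+\frac4n\,\tau_{[a}{}^{ef}g_{b][c}\tau_{d]ef}.$$ Here $\nabla$ is the Levi-Civita connection of $g$, indices are raised with the inverse of $g$, square brackets denote skew-symmetrisation with weight one (over $a,b$ and over $c,d$ in the identity), and the curvature conventions are $2\nabla_{[a}\nabla_{b]}V^c=R_{ab}{}^c{}_dV^d$, $\mathrm{Ric}_{ab}=R_{ca}{}^c{}_b$, $\mathrm{Sc}=g^{ab}\mathrm{Ric}_{ab}$, $\mathrm P_{ab}=\frac1n\bigl(\mathrm{Ric}_{ab}-\frac{\mathrm{Sc}}{2(n+1)}g_{ab}\bigr)$, $W_{abcd}=R_{abcd}-4\,g_{[a|[c}\mathrm P_{d]|b]}$. -/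

import Mathlib

open scoped Manifold ContDiff Topology

noncomputable section

namespace OpticalGeom

/-! ### Lorentzian metrics, conformal structures, optical geometries

`M` is a smooth manifold of dimension `n + 2`, modelled on `ℝⁿ⁺²`. -/

/-- The model space `ℝⁿ⁺²`. -/
abbrev Model (n : ℕ) : Type := EuclideanSpace ℝ (Fin (n + 2))

/-- A (rough) vector field on `M`. -/
abbrev VField (n : ℕ) (M : Type*) [TopologicalSpace M] [ChartedSpace (Model n) M] : Type _ :=
  ∀ x : M, TangentSpace (𝓡 (n + 2)) x

/-- The vector field `V` is smooth on the set `U`. -/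
def SmoothOn {n : ℕ} {M : Type*} [TopologicalSpace M] [ChartedSpace (Model n) M]
    [IsManifold (𝓡 (n + 2)) ∞ M] (V : VField n M) (U : Set M) : Prop :=
  ContMDiffOn (𝓡 (n + 2)) (𝓡 (n + 2)).tangent ∞
    (fun x ↦ (⟨x, V x⟩ : TangentBundle (𝓡 (n + 2)) M)) U

/-- A smooth Lorentzian metric, of signature `(+, …, +, -)`: at each point there is a timelike
vector whose orthogonal complement is positive definite. -/
structure LorentzMetric (n : ℕ) (M : Type*) [TopologicalSpace M] [ChartedSpace (Model n) M]
    [IsManifold (𝓡 (n + 2)) ∞ M] where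
  form (x : M) :
    TangentSpace (𝓡 (n + 2)) x →L[ℝ] TangentSpace (𝓡 (n + 2)) x →L[ℝ] ℝ
  symm (x : M) (v w : TangentSpace (𝓡 (n + 2)) x) : form x v w = form x w v
  signature (x : M) : ∃ t : TangentSpace (𝓡 (n + 2)) x, form x t t < 0 ∧
    ∀ v : TangentSpace (𝓡 (n + 2)) x, form x t v = 0 → v ≠ 0 → 0 < form x v v
  contMDiff : ContMDiff (𝓡 (n + 2))
    ((𝓡 (n + 2)).prod 𝓘(ℝ, Model n →L[ℝ] Model n →L[ℝ] ℝ)) ∞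
    (fun x ↦ Bundle.TotalSpace.mk' (Model n →L[ℝ] Model n →L[ℝ] ℝ)
      (E := fun x : M ↦
        TangentSpace (𝓡 (n + 2)) x →L[ℝ] TangentSpace (𝓡 (n + 2)) x →L[ℝ] ℝ) x (form x))

/-- A conformal structure of Lorentzian signature: an equivalence class of Lorentzian metrics
under `ĝ ~ g ↔ ĝ = e^{2φ} g` with `φ` a smooth function. -/
structure ConformalStructure (n : ℕ) (M : Type*) [TopologicalSpace M] [ChartedSpace (Model n) M]
    [IsManifold (𝓡 (n + 2)) ∞ M] where
  metrics : Set (LorentzMetric n M)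
  nonempty : metrics.Nonempty
  mem_iff : ∀ g ∈ metrics, ∀ g' : LorentzMetric n M, g' ∈ metrics ↔
    ∃ φ : M → ℝ, ContMDiff (𝓡 (n + 2)) 𝓘(ℝ, ℝ) ∞ φ ∧
      ∀ (x : M) (v w : TangentSpace (𝓡 (n + 2)) x),
        g'.form x v w = Real.exp (2 * φ x) * g.form x v w

/-- A conformal optical geometry `(M, c, K)` of dimension `n + 2`: a Lorentzian conformal structure
together with a smooth null line distribution `K`. -/
structure OpticalGeometry (n : ℕ) (M : Type*) [TopologicalSpace M] [ChartedSpace (Model n) M]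
    [IsManifold (𝓡 (n + 2)) ∞ M] where
  c : ConformalStructure n M
  K : ∀ x : M, Submodule ℝ (TangentSpace (𝓡 (n + 2)) x)
  rank_one (x : M) : Module.finrank ℝ (K x) = 1
  smooth (x : M) : ∃ U : Set M, IsOpen U ∧ x ∈ U ∧ ∃ k : VField n M,
    SmoothOn k U ∧ ∀ y ∈ U, k y ∈ K y ∧ k y ≠ 0
  null : ∀ g ∈ c.metrics, ∀ (x : M), ∀ v ∈ K x, g.form x v v = 0

/-- `k` is an optical vector field over the open set `U`: a nowhere vanishing smooth section of `K`
over `U`. -/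
structure OpticalGeometry.IsOptical {n : ℕ} {M : Type*} [TopologicalSpace M]
    [ChartedSpace (Model n) M] [IsManifold (𝓡 (n + 2)) ∞ M] (O : OpticalGeometry n M)
    (U : Set M) (k : VField n M) : Prop where
  isOpen : IsOpen U
  smooth : SmoothOn k U
  mem : ∀ x ∈ U, k x ∈ O.K x
  ne_zero : ∀ x ∈ U, k x ≠ 0

/-- `V` is a smooth section of `K^⊥` over `U`; here `g` is a metric in the conformal class
(`K^⊥` does not depend on which one). -/
def OpticalGeometry.IsPerpSection {n : ℕ} {M : Type*} [TopologicalSpace M]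
    [ChartedSpace (Model n) M] [IsManifold (𝓡 (n + 2)) ∞ M] (O : OpticalGeometry n M)
    (g : LorentzMetric n M) (U : Set M) (V : VField n M) : Prop :=
  SmoothOn V U ∧ ∀ x ∈ U, ∀ u ∈ O.K x, g.form x u (V x) = 0

/-! ### Lie derivatives, geodesic and non-shearing congruences -/

/-- `(𝓛_k κ)(V)` at `x`, where `κ = g(k, ·)`: `k (κ(V)) - κ([k, V])`. -/
def lieDerivForm {n : ℕ} {M : Type*} [TopologicalSpace M] [ChartedSpace (Model n) M]
    [IsManifold (𝓡 (n + 2)) ∞ M] (g : LorentzMetric n M) (k V : VField n M) (x : M) : ℝ :=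
  mvfderiv (𝓡 (n + 2)) (fun y ↦ g.form y (k y) (V y)) x (k x)
    - g.form x (k x) (VectorField.mlieBracket (𝓡 (n + 2)) k V x)

/-- `(𝓛_k g)(V, W)` at `x`: `k (g(V, W)) - g([k, V], W) - g(V, [k, W])`. -/
def lieDerivMetric {n : ℕ} {M : Type*} [TopologicalSpace M] [ChartedSpace (Model n) M]
    [IsManifold (𝓡 (n + 2)) ∞ M] (g : LorentzMetric n M) (k V W : VField n M) (x : M) : ℝ :=
  mvfderiv (𝓡 (n + 2)) (fun y ↦ g.form y (V y) (W y)) x (k x)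
    - g.form x (VectorField.mlieBracket (𝓡 (n + 2)) k V x) (W x)
    - g.form x (V x) (VectorField.mlieBracket (𝓡 (n + 2)) k W x)

/-- The curves tangent to `K` are geodesics: `(𝓛_k κ)(V) = 0` for all optical vector fields `k`,
with `κ = g(k, ·)`, and all sections `V` of `K^⊥`. -/
def OpticalGeometry.IsGeodesic {n : ℕ} {M : Type*} [TopologicalSpace M]
    [ChartedSpace (Model n) M] [IsManifold (𝓡 (n + 2)) ∞ M] (O : OpticalGeometry n M) : Prop :=
  ∀ g ∈ O.c.metrics, ∀ (U : Set M) (k V : VField n M), O.IsOptical U k → O.IsPerpSection g U V →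
    ∀ x ∈ U, lieDerivForm g k V x = 0

/-- The congruence tangent to `K` is non-shearing: the conformal structure of the screen bundle
`K^⊥ / K` is preserved along `K`. That is, for every optical vector field `k`, the part of
`½ 𝓛_k g` restricted to `K^⊥` that is trace-free with respect to the screen metric (the shear of
`k`) vanishes, so that this restriction is a multiple `ρ` of `g` at each point. -/
def OpticalGeometry.IsNonShearing {n : ℕ} {M : Type*} [TopologicalSpace M]
    [ChartedSpace (Model n) M] [IsManifold (𝓡 (n + 2)) ∞ M] (O : OpticalGeometry n M) : Prop :=
  ∀ g ∈ O.c.metrics, ∀ (U : Set M) (k : VField n M), O.IsOptical U k → ∀ x ∈ U, ∃ ρ : ℝ,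
    ∀ V W : VField n M, O.IsPerpSection g U V → O.IsPerpSection g U W →
      (1 / 2) * lieDerivMetric g k V W x = ρ * g.form x (V x) (W x)

/-! ### Tensor calculus in local coordinates

Tensors are given by their components, which are functions of the coordinates `y ∈ ℝⁿ⁺²`.
`G a b` are the components `g_{ab}` of a metric. -/

/-- Skew-symmetrisation `T_{[ab]}`. -/
def skew₂ {ι : Type*} (T : ι → ι → ℝ) (a b : ι) : ℝ := (T a b - T b a) / 2

/-- Skew-symmetrisation `T_{[abc]}`. -/
def skew₃ {ι : Type*} (T : ι → ι → ι → ℝ) (a b c : ι) : ℝ :=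
  (T a b c + T b c a + T c a b - T b a c - T a c b - T c b a) / 6

/-- Partial derivative `∂_a f`. -/
def pd {n : ℕ} (a : Fin (n + 2)) (f : Model n → ℝ) (y : Model n) : ℝ :=
  fderiv ℝ f y (EuclideanSpace.single a 1)

/-- Components `g^{ab}` of the inverse metric. -/
def invG {n : ℕ} (G : Fin (n + 2) → Fin (n + 2) → Model n → ℝ) (a b : Fin (n + 2))
    (y : Model n) : ℝ :=
  (Matrix.of fun i j ↦ G i j y)⁻¹ a b

/-- Christoffel symbols `Γ^c_{ab}` of the Levi-Civita connection,
`½ g^{cd} (∂_a g_{bd} + ∂_b g_{ad} - ∂_d g_{ab})`. -/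
def christoffel {n : ℕ} (G : Fin (n + 2) → Fin (n + 2) → Model n → ℝ) (c a b : Fin (n + 2))
    (y : Model n) : ℝ :=
  (1 / 2) * ∑ d, invG G c d y * (pd a (G b d) y + pd b (G a d) y - pd d (G a b) y)

/-- Levi-Civita covariant derivative `∇_a α_b` of a 1-form. -/
def covDeriv {n : ℕ} (G : Fin (n + 2) → Fin (n + 2) → Model n → ℝ)
    (α : Fin (n + 2) → Model n → ℝ) (a b : Fin (n + 2)) (y : Model n) : ℝ :=
  pd a (α b) y - ∑ c, christoffel G c a b y * α c y

/-- Riemann tensor `R_{ab}{}^c{}_d`, with the convention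
`(∇_a ∇_b - ∇_b ∇_a) V^c = R_{ab}{}^c{}_d V^d`. -/
def riemann {n : ℕ} (G : Fin (n + 2) → Fin (n + 2) → Model n → ℝ) (a b c d : Fin (n + 2))
    (y : Model n) : ℝ :=
  pd a (christoffel G c b d) y - pd b (christoffel G c a d) y
    + ∑ e, (christoffel G c a e y * christoffel G e b d y
      - christoffel G c b e y * christoffel G e a d y)

/-- Riemann tensor with all indices down, `R_{abcd} = g_{ce} R_{ab}{}^e{}_d`. -/
def riemannLow {n : ℕ} (G : Fin (n + 2) → Fin (n + 2) → Model n → ℝ) (a b c d : Fin (n + 2))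
    (y : Model n) : ℝ :=
  ∑ e, G c e y * riemann G a b e d y

/-- Ricci tensor `Ric_{ab} = R_{ca}{}^c{}_b`. -/
def ricci {n : ℕ} (G : Fin (n + 2) → Fin (n + 2) → Model n → ℝ) (a b : Fin (n + 2))
    (y : Model n) : ℝ :=
  ∑ c, riemann G c a c b y

/-- Ricci scalar `Sc = g^{ab} Ric_{ab}`. -/
def scalarCurv {n : ℕ} (G : Fin (n + 2) → Fin (n + 2) → Model n → ℝ) (y : Model n) : ℝ :=
  ∑ a, ∑ b, invG G a b y * ricci G a b y

/-- Schouten tensor in dimension `n + 2`: `P_{ab} = (Ric_{ab} - Sc / (2 (n + 1)) g_{ab}) / n`. -/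
def schouten {n : ℕ} (G : Fin (n + 2) → Fin (n + 2) → Model n → ℝ) (a b : Fin (n + 2))
    (y : Model n) : ℝ :=
  (1 / (n : ℝ)) * (ricci G a b y - scalarCurv G y / (2 * ((n : ℝ) + 1)) * G a b y)

/-- Weyl tensor `W_{abcd}`, defined by `R_{abcd} = W_{abcd} + 4 g_{[a|[c} P_{d]|b]}`. -/
def weyl {n : ℕ} (G : Fin (n + 2) → Fin (n + 2) → Model n → ℝ) (a b c d : Fin (n + 2))
    (y : Model n) : ℝ :=
  riemannLow G a b c d y
    - 4 * skew₂ (fun a b ↦ skew₂ (fun c d ↦ G a c y * schouten G d b y) c d) a b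

/-! ### Components of geometric objects in a chart -/

/-- Components `g_{ab} = g(∂_a, ∂_b)` of a metric in the chart `e`, as functions of the
coordinates. -/
def metricComp {n : ℕ} {M : Type*} [TopologicalSpace M] [ChartedSpace (Model n) M]
    [IsManifold (𝓡 (n + 2)) ∞ M] (g : LorentzMetric n M) (e : OpenPartialHomeomorph M (Model n))
    (a b : Fin (n + 2)) (y : Model n) : ℝ :=
  g.form (e.symm y)
    (mfderiv (𝓡 (n + 2)) (𝓡 (n + 2)) e.symm y (EuclideanSpace.single a (1 : ℝ) : Model n))
    (mfderiv (𝓡 (n + 2)) (𝓡 (n + 2)) e.symm y (EuclideanSpace.single b (1 : ℝ) : Model n))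

/-- Components `k^a` of a vector field in the chart `e`, as functions of the coordinates. -/
def vecComp {n : ℕ} {M : Type*} [TopologicalSpace M] [ChartedSpace (Model n) M]
    (k : VField n M) (e : OpenPartialHomeomorph M (Model n)) (a : Fin (n + 2)) (y : Model n) : ℝ :=
  let v : Model n := mfderiv (𝓡 (n + 2)) (𝓡 (n + 2)) e (e.symm y) (k (e.symm y))
  v a

/-- Lowering an index: `κ_a = g_{ab} k^b`. -/
def lower {n : ℕ} (G : Fin (n + 2) → Fin (n + 2) → Model n → ℝ)
    (k : Fin (n + 2) → Model n → ℝ) (a : Fin (n + 2)) (y : Model n) : ℝ :=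
  ∑ b, G a b y * k b y

/-- The twist 3-form `τ_{abc} = 3 κ_{[a} ∇_b κ_{c]}` of a 1-form `κ`. -/
def twist {n : ℕ} (G : Fin (n + 2) → Fin (n + 2) → Model n → ℝ)
    (κ : Fin (n + 2) → Model n → ℝ) (a b c : Fin (n + 2)) (y : Model n) : ℝ :=
  3 * skew₃ (fun a b c ↦ κ a y * covDeriv G κ b c y) a b c

end OpticalGeom

end

/-! Write κ = g(k, ·), let B be the endomorphism v ↦ ∇_v k, and let F be the skew part of g(B ·, ·).
Since k is null, g(Bv, k) = 0. Since k itself lies in k^⊥, vanishing shear tested on k and a vector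
of k^⊥ forces ∇_k k = λ k (`nablaVec_self`), so F(k, ·) = (λ/2) κ. On k^⊥, and modulo k, B is ρ plus
F♯, where g(F♯ v, w) = F(v, w).

Differentiating g(BV, V) = ρ g(V, V) along k and inserting the Ricci identity gives the Sachs
equation g(R(k, v)k, v) = σ g(v, v) + g(B²v, v) on k^⊥ (`curv_shearFree`). Hence the tidal form Q(v,
w) = g(R(v, k)w, k) equals, on k^⊥, a multiple of g minus F(v, F♯w). That multiple involves the
derivative of ρ, but the full trace of Q is -Ric(k, k), and this determines it
(`IsInverseForm.eq_on_perp`). The outcome, `tidalForm_perp`, says that on k^⊥ the form Q + (Ric(k,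
k)/n) g is ((|F|² + 2μ²)/n) g - F(·, F♯ ·) with μ = λ/2.

Skewing a bilinear form with κ on both sides amounts to evaluating it on the vectors κ_a e_b - κ_b
e_a, which lie in k^⊥. The left side of the theorem is therefore Q + (Ric(k, k)/n) g on such
vectors: the other Schouten terms of the Weyl tensor carry a factor κ that the skewing kills, or a
factor g(k, k). On the right side τ is κ ∧ F, and its two contractions are -F(·, F♯ ·) on the same
vectors (`IsInverseForm.sum_wedge_wedge`) and (|F|² + 2μ²) κ_a κ_d (`IsInverseForm.sum_wedge_sq`).

All of this is done for functions on the model space. The shear condition on the manifold is carried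
there by extending vectors of k^⊥ to local sections and computing the Lie derivative in the chart
(`OpticalGeometry.IsOptical.shear_chart`). -/

noncomputable section

namespace OpticalGeom

/-! ### Levi-Civita curvature and null shear-free fields on a normed space. -/

section Calculus

variable {E F : Type*} [NormedAddCommGroup E] [NormedSpace ℝ E]
  [NormedAddCommGroup F] [NormedSpace ℝ F]

theorem fderiv_bilin_apply {g : E → E →L[ℝ] E →L[ℝ] F} {X Y : E → E} {y : E}
    (hg : DifferentiableAt ℝ g y) (hX : DifferentiableAt ℝ X y) (hY : DifferentiableAt ℝ Y y)
    (u : E) :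
    fderiv ℝ (fun z ↦ g z (X z) (Y z)) y u = fderiv ℝ g y u (X y) (Y y)
      + g y (fderiv ℝ X y u) (Y y) + g y (X y) (fderiv ℝ Y y u) := by
  have h := ((hg.hasFDerivAt.clm_apply hX.hasFDerivAt).clm_apply hY.hasFDerivAt).fderiv
  rw [h]
  simp only [_root_.add_apply, ContinuousLinearMap.comp_apply,
    ContinuousLinearMap.flip_apply]
  abel

theorem fderiv_bilin_const {g : E → E →L[ℝ] E →L[ℝ] F} {y : E}
    (hg : DifferentiableAt ℝ g y) (u v w : E) :
    fderiv ℝ (fun z ↦ g z v w) y u = fderiv ℝ g y u v w := by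
  rw [fderiv_bilin_apply (X := fun _ ↦ v) (Y := fun _ ↦ w) hg (by fun_prop) (by fun_prop)]
  simp

/-- The curvature `R(u, v) w` of the connection with Christoffel map `Γ`. -/
def curv (Γ : E → E →L[ℝ] E →L[ℝ] E) (y u v w : E) : E :=
  fderiv ℝ Γ y u v w - fderiv ℝ Γ y v u w + Γ y u (Γ y v w) - Γ y v (Γ y u w)

theorem curv_swap (Γ : E → E →L[ℝ] E →L[ℝ] E) (y u v w : E) :
    curv Γ y u v w = -curv Γ y v u w := by
  simp only [curv]; abel

/-- Near `y`, `Γ` is the Levi-Civita connection of the symmetric form `g`. -/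
structure IsLeviCivita (g : E → E →L[ℝ] E →L[ℝ] ℝ) (Γ : E → E →L[ℝ] E →L[ℝ] E) (y : E) :
    Prop where
  contDiff : ContDiffAt ℝ 2 g y
  differentiable : DifferentiableAt ℝ Γ y
  symm : ∀ᶠ z in 𝓝 y, ∀ v w, g z v w = g z w v
  torsionFree : ∀ᶠ z in 𝓝 y, ∀ v w, Γ z v w = Γ z w v
  compat : ∀ᶠ z in 𝓝 y, ∀ u v w,
    fderiv ℝ g z u v w = g z (Γ z u v) w + g z v (Γ z u w)

variable {g : E → E →L[ℝ] E →L[ℝ] ℝ} {Γ : E → E →L[ℝ] E →L[ℝ] E} {y : E}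

theorem fderiv_torsionFree (h : IsLeviCivita g Γ y) (u v w : E) :
    fderiv ℝ Γ y u v w = fderiv ℝ Γ y u w v := by
  rw [← fderiv_bilin_const h.differentiable, ← fderiv_bilin_const h.differentiable]
  have : (fun z ↦ Γ z v w) =ᶠ[𝓝 y] fun z ↦ Γ z w v := by
    filter_upwards [h.torsionFree] with z hz using hz v w
  rw [this.fderiv_eq]

theorem curv_bianchi (h : IsLeviCivita g Γ y) (u v w : E) :
    curv Γ y u v w + curv Γ y v w u + curv Γ y w u v = 0 := by
  have t := h.torsionFree.self_of_nhds
  simp only [curv]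
  rw [fderiv_torsionFree h u v w, fderiv_torsionFree h v w u, fderiv_torsionFree h w u v,
    t v w, t u w, t u v]
  abel

/-- The second derivative of z ↦ g z w x is symmetric. Expanding it by metric compatibility in both
orders and subtracting leaves the two curvature terms. -/
theorem curv_skew (h : IsLeviCivita g Γ y) (u v w x : E) :
    g y (curv Γ y u v w) x = -g y w (curv Γ y u v x) := by
  have hg : DifferentiableAt ℝ g y := h.contDiff.differentiableAt (by norm_num)
  have hg' : ∀ᶠ z in 𝓝 y, DifferentiableAt ℝ g z :=
    (h.contDiff.eventually (by norm_num)).mono fun z hz ↦ hz.differentiableAt (by norm_num)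
  have hf : ContDiffAt ℝ 2 (fun z ↦ g z w x) y :=
    (h.contDiff.clm_apply contDiffAt_const).clm_apply contDiffAt_const
  have hdf : DifferentiableAt ℝ (fderiv ℝ fun z ↦ g z w x) y :=
    (hf.fderiv_right (m := 1) (by norm_num)).differentiableAt (by norm_num)
  have hs : IsSymmSndFDerivAt ℝ (fun z ↦ g z w x) y := hf.isSymmSndFDerivAt (by simp)
  have c := h.compat.self_of_nhds
  have key : ∀ u v : E, fderiv ℝ (fderiv ℝ fun z ↦ g z w x) y u v =
      (fderiv ℝ g y u (Γ y v w) x + g y (fderiv ℝ Γ y u v w) x)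
      + (fderiv ℝ g y u w (Γ y v x) + g y w (fderiv ℝ Γ y u v x)) := by
    intro u v
    have hΓ : ∀ a b : E, DifferentiableAt ℝ (fun z ↦ Γ z a b) y := fun a b ↦
      (h.differentiable.clm_apply (by fun_prop)).clm_apply (by fun_prop)
    have e1 : fderiv ℝ (fun z ↦ fderiv ℝ (fun z ↦ g z w x) z v) y u
        = fderiv ℝ (fderiv ℝ fun z ↦ g z w x) y u v := by
      have := (hdf.hasFDerivAt.clm_apply (hasFDerivAt_const v y)).fderiv
      rw [this]
      simp
    have e2 : (fun z ↦ fderiv ℝ (fun z ↦ g z w x) z v) =ᶠ[𝓝 y]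
        fun z ↦ g z (Γ z v w) x + g z w (Γ z v x) := by
      filter_upwards [h.compat, hg'] with z hz hgz
      rw [fderiv_bilin_const hgz, hz v w x]
    rw [← e1, e2.fderiv_eq, fderiv_fun_add
      ((hg.clm_apply (hΓ v w)).clm_apply (by fun_prop))
      ((hg.clm_apply (by fun_prop)).clm_apply (hΓ v x)), _root_.add_apply,
      fderiv_bilin_apply hg (hΓ v w) (by fun_prop), fderiv_bilin_apply hg (by fun_prop) (hΓ v x),
      fderiv_bilin_const h.differentiable, fderiv_bilin_const h.differentiable]
    simp
  have h1 := key u v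
  have h2 := key v u
  rw [hs.eq v u, h1, c, c, c, c] at h2
  simp only [curv, map_add, map_sub, _root_.add_apply, _root_.sub_apply]
  linarith

/-- The octahedron argument: four instances of the first Bianchi identity, combined by the
skew-symmetry in each pair. -/
theorem curv_pair_symm (h : IsLeviCivita g Γ y) (u v w x : E) :
    g y (curv Γ y u v w) x = g y (curv Γ y w x u) v := by
  have s := h.symm.self_of_nhds
  have bi : ∀ a b c d : E, g y (curv Γ y a b c) d + g y (curv Γ y b c a) d
      + g y (curv Γ y c a b) d = 0 := by
    intro a b c d
    have := congrArg (fun z ↦ g y z d) (curv_bianchi h a b c)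
    simpa using this
  have sw : ∀ a b c d : E, g y (curv Γ y a b c) d = -g y (curv Γ y b a c) d := by
    intro a b c d
    rw [curv_swap]; simp
  have sk : ∀ a b c d : E, g y (curv Γ y a b c) d = -g y (curv Γ y a b d) c := by
    intro a b c d
    rw [curv_skew h, s]
  have b1 := bi u v w x
  have b2 := bi v w x u
  have b3 := bi w x u v
  have b4 := bi x u v w
  linarith [sk u v w x, sk v w u x, sk w u v x, sk v w x u, sk w x v u, sk x v w u,
    sk w x u v, sk x u w v, sk u w x v, sk x u v w, sk u v x w, sk v x u w,
    sw w u v x, sw u w x v, sw x v w u, sw v x u w, sw x v u w, sw u w v x]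

/-- `∇_v k`. -/
def nablaVec (Γ : E → E →L[ℝ] E →L[ℝ] E) (k : E → E) (y : E) : E →L[ℝ] E :=
  fderiv ℝ k y + (Γ y).flip (k y)

theorem nablaVec_apply (Γ : E → E →L[ℝ] E →L[ℝ] E) (k : E → E) (y v : E) :
    nablaVec Γ k y v = fderiv ℝ k y v + Γ y v (k y) := rfl

theorem differentiableAt_nablaVec (h : IsLeviCivita g Γ y) {k : E → E}
    (hk : ContDiffAt ℝ 2 k y) : DifferentiableAt ℝ (nablaVec Γ k) y := by
  have hdk : DifferentiableAt ℝ (fderiv ℝ k) y :=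
    (hk.fderiv_right (m := 1) (by norm_num)).differentiableAt (by norm_num)
  have hΓ : DifferentiableAt ℝ (fun z ↦ (Γ z).flip) y :=
    (ContinuousLinearMap.flipₗᵢ ℝ E E E).toContinuousLinearEquiv.differentiableAt.comp y
      h.differentiable
  exact hdk.add (hΓ.clm_apply (hk.differentiableAt (by norm_num)))

/-- The Ricci identity. -/
theorem curv_apply_eq (h : IsLeviCivita g Γ y) {k : E → E} (hk : ContDiffAt ℝ 2 k y) (u v : E) :
    curv Γ y u v (k y) = fderiv ℝ (nablaVec Γ k) y u v - fderiv ℝ (nablaVec Γ k) y v u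
      + Γ y u (nablaVec Γ k y v) - Γ y v (nablaVec Γ k y u) := by
  have hk1 : DifferentiableAt ℝ k y := hk.differentiableAt (by norm_num)
  have hdk : DifferentiableAt ℝ (fderiv ℝ k) y :=
    (hk.fderiv_right (m := 1) (by norm_num)).differentiableAt (by norm_num)
  have hs : IsSymmSndFDerivAt ℝ k y := hk.isSymmSndFDerivAt (by simp)
  have key : ∀ u v : E, fderiv ℝ (nablaVec Γ k) y u v =
      fderiv ℝ (fderiv ℝ k) y u v + fderiv ℝ Γ y u v (k y) + Γ y v (fderiv ℝ k y u) := by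
    intro u v
    have e1 : fderiv ℝ (fun z ↦ nablaVec Γ k z v) y u = fderiv ℝ (nablaVec Γ k) y u v := by
      have := ((differentiableAt_nablaVec h hk).hasFDerivAt.clm_apply
        (hasFDerivAt_const v y)).fderiv
      rw [this]; simp
    have e2 : fderiv ℝ (fun z ↦ fderiv ℝ k z v) y u = fderiv ℝ (fderiv ℝ k) y u v := by
      have := (hdk.hasFDerivAt.clm_apply (hasFDerivAt_const v y)).fderiv
      rw [this]; simp
    rw [← e1, ← e2]
    simp only [nablaVec_apply]
    rw [fderiv_fun_add (by fun_prop) ((h.differentiable.clm_apply (by fun_prop)).clm_apply hk1),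
      _root_.add_apply, fderiv_bilin_apply h.differentiable (by fun_prop) hk1]
    simp [add_assoc]
  rw [key, key, hs.eq v u]
  simp only [curv, nablaVec_apply, map_add]
  abel

/-- `k` is null and shear-free near `y`, and does not vanish at `y`. -/
structure IsShearFree (g : E → E →L[ℝ] E →L[ℝ] ℝ) (k : E → E) (y : E) : Prop where
  contDiff : ContDiffAt ℝ 2 k y
  null : ∀ᶠ z in 𝓝 y, g z (k z) (k z) = 0
  ne_zero : ∃ t, g y (k y) t ≠ 0
  spacelike : ∃ v, g y (k y) v = 0 ∧ g y v v ≠ 0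
  nondegenerate : ∀ᶠ z in 𝓝 y, ∀ p, (∀ x, g z p x = 0) → p = 0
  shear : ∀ᶠ z in 𝓝 y, ∃ ρ : ℝ, ∀ v w, g z (k z) v = 0 → g z (k z) w = 0 →
    fderiv ℝ g z (k z) v w + g z (fderiv ℝ k z v) w + g z v (fderiv ℝ k z w) = 2 * ρ * g z v w

variable {k : E → E}

/-- Differentiate g(k, k) = 0, which holds on a whole neighbourhood. -/
theorem nablaVec_inner_self (h : IsLeviCivita g Γ y) (hk : IsShearFree g k y) :
    ∀ᶠ z in 𝓝 y, ∀ v, g z (nablaVec Γ k z v) (k z) = 0 := by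
  have hd : ∀ᶠ z in 𝓝 y, DifferentiableAt ℝ g z :=
    (h.contDiff.eventually (by norm_num)).mono fun z hz ↦ hz.differentiableAt (by norm_num)
  have hkd : ∀ᶠ z in 𝓝 y, DifferentiableAt ℝ k z :=
    (hk.contDiff.eventually (by norm_num)).mono fun z hz ↦ hz.differentiableAt (by norm_num)
  filter_upwards [hd, hkd, h.symm, h.compat, hk.null.eventually_nhds] with z h1 h2 s c h0 v
  have e := Filter.EventuallyEq.fderiv_eq (𝕜 := ℝ)
    (show (fun z ↦ g z (k z) (k z)) =ᶠ[𝓝 z] fun _ ↦ (0 : ℝ) from h0)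
  have e' := congrArg (fun L : E →L[ℝ] ℝ ↦ L v) e
  simp only [fderiv_bilin_apply h1 h2 h2, c] at e'
  simp only [fderiv_fun_const, Pi.zero_apply, _root_.zero_apply] at e'
  rw [s (k z) (fderiv ℝ k z v), s (k z) (Γ z v (k z))] at e'
  rw [nablaVec_apply, map_add, _root_.add_apply]
  linarith

/-- The Lie derivative of g along k is twice the symmetrisation of ∇κ; compatibility and vanishing
torsion convert the partial derivatives into covariant ones. -/
theorem nablaVec_shear (h : IsLeviCivita g Γ y) (hk : IsShearFree g k y) :
    ∀ᶠ z in 𝓝 y, ∃ ρ : ℝ, ∀ v w, g z (k z) v = 0 → g z (k z) w = 0 →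
      g z (nablaVec Γ k z v) w + g z (nablaVec Γ k z w) v = 2 * ρ * g z v w := by
  filter_upwards [h.symm, h.torsionFree, h.compat, hk.shear] with z s t c hz
  obtain ⟨ρ, hρ⟩ := hz
  refine ⟨ρ, fun v w hv hw ↦ ?_⟩
  rw [← hρ v w hv hw, c]
  simp only [nablaVec_apply, map_add, _root_.add_apply]
  rw [t (k z) v, t (k z) w, s v (Γ z w (k z)), s v (fderiv ℝ k z w)]
  ring

/-- A vector orthogonal to `k^⊥` is a multiple of `k`. -/
theorem eq_smul_of_orthogonal {b : E →L[ℝ] E →L[ℝ] ℝ} {k t p : E}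
    (nd : ∀ p, (∀ x, b p x = 0) → p = 0)
    (ht : b k t ≠ 0) (hp : ∀ x, b k x = 0 → b p x = 0) : p = (b p t / b k t) • k := by
  rw [← sub_eq_zero]
  refine nd _ fun x ↦ ?_
  -- Test against the component of x in k^⊥ along the transverse vector t.
  have := hp (x - (b k x / b k t) • t) (by simp; field_simp; ring)
  simp only [map_sub, map_smul, smul_eq_mul, _root_.sub_apply,
    _root_.smul_apply] at this ⊢
  field_simp at this ⊢
  linarith

/-- The null congruence is geodesic. -/
theorem nablaVec_self (h : IsLeviCivita g Γ y) (hk : IsShearFree g k y) {t : E}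
    (ht : g y (k y) t ≠ 0) :
    ∀ᶠ z in 𝓝 y, nablaVec Γ k z (k z) = (g z (nablaVec Γ k z (k z)) t / g z (k z) t) • k z := by
  have hg : DifferentiableAt ℝ g y := h.contDiff.differentiableAt (by norm_num)
  have hk1 : DifferentiableAt ℝ k y := hk.contDiff.differentiableAt (by norm_num)
  have hct : ContinuousAt (fun z ↦ g z (k z) t) y :=
    ((hg.clm_apply hk1).clm_apply (by fun_prop)).continuousAt
  filter_upwards [nablaVec_inner_self h hk, nablaVec_shear h hk, hk.nondegenerate, hk.null,
    hct.eventually_ne ht] with z h1 h2 nd h0 htz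
  obtain ⟨ρ, hρ⟩ := h2
  refine eq_smul_of_orthogonal nd htz fun x hx ↦ ?_
  -- As k is null it lies in k^⊥, so the shear condition applies to the pair (k, x); two of its
  -- three terms vanish.
  have := hρ (k z) x h0 hx
  rw [h1, hx] at this
  linarith

end Calculus

/-! ### The Sachs equation. -/

section Calculus

theorem differentiableAt_fun_div {E : Type*} [NormedAddCommGroup E] [NormedSpace ℝ E]
    {f h : E → ℝ} {y : E} (hf : DifferentiableAt ℝ f y)
    (hh : DifferentiableAt ℝ h y) (h0 : h y ≠ 0) : DifferentiableAt ℝ (fun z ↦ f z / h z) y := by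
  simp only [div_eq_mul_inv]
  exact hf.mul (hh.fun_inv h0)

variable {E : Type*} [NormedAddCommGroup E] [NormedSpace ℝ E]
  {g : E → E →L[ℝ] E →L[ℝ] ℝ} {Γ : E → E →L[ℝ] E →L[ℝ] E} {y : E} {k : E → E}

/-- The projection of the constant field `v` to `k^⊥` along `t`. -/
def perpProj (g : E → E →L[ℝ] E →L[ℝ] ℝ) (k : E → E) (t v : E) (z : E) : E :=
  v - (g z (k z) v / g z (k z) t) • t

theorem perpProj_orthogonal {t z : E} (ht : g z (k z) t ≠ 0) (v : E) :
    g z (k z) (perpProj g k t v z) = 0 := by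
  simp [perpProj, ht]

theorem perpProj_eq_self {t v z : E} (hv : g z (k z) v = 0) : perpProj g k t v z = v := by
  simp [perpProj, hv]

theorem differentiableAt_perpProj (hg : DifferentiableAt ℝ g y) (hk : DifferentiableAt ℝ k y)
    {t : E} (ht : g y (k y) t ≠ 0) (v : E) : DifferentiableAt ℝ (perpProj g k t v) y := by
  have h : ∀ x, DifferentiableAt ℝ (fun z ↦ g z (k z) x) y := fun x ↦
    (hg.clm_apply hk).clm_apply (by fun_prop)
  exact (differentiableAt_const v).sub ((differentiableAt_fun_div (h v) (h t) ht).smul_const t)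

/-- The Raychaudhuri-Sachs equation of a shear-free null geodesic congruence. -/
theorem curv_shearFree (h : IsLeviCivita g Γ y) (hk : IsShearFree g k y) :
    ∃ σ : ℝ, ∀ v, g y (k y) v = 0 → g y (curv Γ y (k y) v (k y)) v
      = σ * g y v v + g y (nablaVec Γ k y (nablaVec Γ k y v)) v := by
  obtain ⟨t, ht⟩ := hk.ne_zero
  obtain ⟨v₀, hv₀, hv₀'⟩ := hk.spacelike
  have hg : DifferentiableAt ℝ g y := h.contDiff.differentiableAt (by norm_num)
  have hk1 : DifferentiableAt ℝ k y := hk.contDiff.differentiableAt (by norm_num)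
  have hB : DifferentiableAt ℝ (nablaVec Γ k) y := differentiableAt_nablaVec h hk.contDiff
  have hV : ∀ v, DifferentiableAt ℝ (perpProj g k t v) y := differentiableAt_perpProj hg hk1 ht
  have hct : ∀ᶠ z in 𝓝 y, g z (k z) t ≠ 0 :=
    ((hg.clm_apply hk1).clm_apply (by fun_prop)).continuousAt.eventually_ne ht
  have s := h.symm.self_of_nhds
  have tf := h.torsionFree.self_of_nhds
  have c := h.compat.self_of_nhds
  -- the geodesic equation `∇_k k = lam k`
  set lam : E → ℝ := fun z ↦ g z (nablaVec Γ k z (k z)) t / g z (k z) t with hlam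
  have hlamd : DifferentiableAt ℝ lam y :=
    differentiableAt_fun_div ((hg.clm_apply (hB.clm_apply hk1)).clm_apply (by fun_prop))
      ((hg.clm_apply hk1).clm_apply (by fun_prop)) ht
  have geo : ∀ᶠ z in 𝓝 y, nablaVec Γ k z (k z) = lam z • k z := nablaVec_self h hk ht
  have geo0 := geo.self_of_nhds
  have dgeo : ∀ v, fderiv ℝ (nablaVec Γ k) y v (k y) + nablaVec Γ k y (fderiv ℝ k y v)
      = fderiv ℝ lam y v • k y + lam y • fderiv ℝ k y v := by
    intro v
    have e := congrArg (fun L : E →L[ℝ] E ↦ L v) (Filter.EventuallyEq.fderiv_eq (𝕜 := ℝ)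
      (show (fun z ↦ nablaVec Γ k z (k z)) =ᶠ[𝓝 y] fun z ↦ lam z • k z from geo))
    simp only [(hB.hasFDerivAt.clm_apply hk1.hasFDerivAt).fderiv,
      (hlamd.hasFDerivAt.fun_smul hk1.hasFDerivAt).fderiv] at e
    simp at e
    rw [add_comm, e, add_comm]
  -- the expansion
  obtain ⟨ρ, hρd, hρ, hρ0⟩ : ∃ ρ : E → ℝ, DifferentiableAt ℝ ρ y ∧
      (∀ v, ∀ᶠ z in 𝓝 y, g z (nablaVec Γ k z (perpProj g k t v z)) (perpProj g k t v z)
        = ρ z * g z (perpProj g k t v z) (perpProj g k t v z)) ∧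
      ∀ v w, g y (k y) v = 0 → g y (k y) w = 0 →
        g y (nablaVec Γ k y v) w + g y (nablaVec Γ k y w) v = 2 * ρ y * g y v w := by
    -- The shear condition provides ρ only pointwise. Dividing by the nonzero square of the field
    -- extending v₀ recovers it as a differentiable function.
    have hne : g y (perpProj g k t v₀ y) (perpProj g k t v₀ y) ≠ 0 := by
      rwa [perpProj_eq_self hv₀]
    have hd : DifferentiableAt ℝ (fun z ↦ g z (perpProj g k t v₀ z) (perpProj g k t v₀ z)) y :=
      (hg.clm_apply (hV v₀)).clm_apply (hV v₀)
    have hc : ∀ᶠ z in 𝓝 y, g z (perpProj g k t v₀ z) (perpProj g k t v₀ z) ≠ 0 :=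
      hd.continuousAt.eventually_ne hne
    have all : ∀ᶠ z in 𝓝 y, ∀ v w, g z (k z) v = 0 → g z (k z) w = 0 →
        g z (nablaVec Γ k z v) w + g z (nablaVec Γ k z w) v
          = 2 * (g z (nablaVec Γ k z (perpProj g k t v₀ z)) (perpProj g k t v₀ z) /
            g z (perpProj g k t v₀ z) (perpProj g k t v₀ z)) * g z v w := by
      filter_upwards [nablaVec_shear h hk, hct, hc] with z ⟨ρ, hz⟩ hz1 hz2 v w hv hw
      rw [hz v w hv hw]
      have := hz _ _ (perpProj_orthogonal hz1 v₀) (perpProj_orthogonal hz1 v₀)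
      rw [show g z (nablaVec Γ k z (perpProj g k t v₀ z)) (perpProj g k t v₀ z)
        = ρ * g z (perpProj g k t v₀ z) (perpProj g k t v₀ z) by linarith]
      field_simp
    refine ⟨_, differentiableAt_fun_div ((hg.clm_apply (hB.clm_apply (hV v₀))).clm_apply (hV v₀)) hd hne, fun v ↦ ?_,
      all.self_of_nhds⟩
    filter_upwards [all, hct] with z hz hz1
    have := hz _ _ (perpProj_orthogonal hz1 v) (perpProj_orthogonal hz1 v)
    linarith
  -- The first term comes from differentiating g(BV, V) = ρ g(V, V) along k. The second comes from
  -- differentiating ∇_k k = λ k along v and pairing with v, using g(Bv, v) = ρ g(v, v).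
  refine ⟨fderiv ℝ ρ y (k y) - lam y * ρ y, fun v hv ↦ ?_⟩
  set V := perpProj g k t v with hVdef
  have hVy : V y = v := perpProj_eq_self hv
  set V' := fderiv ℝ V y (k y) with hV'
  -- the derivative of the expansion equation along `k`
  have e := congrArg (fun L : E →L[ℝ] ℝ ↦ L (k y)) (Filter.EventuallyEq.fderiv_eq (𝕜 := ℝ) (hρ v))
  have hBV : DifferentiableAt ℝ (fun z ↦ nablaVec Γ k z (V z)) y := hB.clm_apply (hV v)
  have dBV : fderiv ℝ (fun z ↦ nablaVec Γ k z (V z)) y (k y)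
      = fderiv ℝ (nablaVec Γ k) y (k y) v + nablaVec Γ k y V' := by
    rw [(hB.hasFDerivAt.clm_apply (hV v).hasFDerivAt).fderiv]
    simp only [_root_.add_apply, ContinuousLinearMap.comp_apply, ContinuousLinearMap.flip_apply]
    rw [← hVdef, hVy, add_comm]
  have hgVV : DifferentiableAt ℝ (fun z ↦ g z (V z) (V z)) y :=
    (hg.clm_apply (hV v)).clm_apply (hV v)
  have e1 := fderiv_bilin_apply (X := fun z ↦ nablaVec Γ k z (V z)) (Y := V) hg hBV (hV v) (k y)
  have e2 := fderiv_bilin_apply (X := V) (Y := V) hg (hV v) (hV v) (k y)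
  have e3 : fderiv ℝ (fun z ↦ ρ z * g z (V z) (V z)) y (k y) = ρ y *
      fderiv ℝ (fun z ↦ g z (V z) (V z)) y (k y) + fderiv ℝ ρ y (k y) * g y v v := by
    rw [(hρd.hasFDerivAt.fun_mul hgVV.hasFDerivAt).fderiv]
    simp [hVy, mul_comm]
  simp only [← hVdef] at e
  rw [e1, e3, e2, dBV, hVy, ← hV'] at e
  -- the derivative of `V` along `k` is `z - Γ(k, v)` with `z ⟂ k`
  have perp := congrArg (fun L : E →L[ℝ] ℝ ↦ L (k y)) (Filter.EventuallyEq.fderiv_eq (𝕜 := ℝ)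
    (show (fun z ↦ g z (k z) (V z)) =ᶠ[𝓝 y] fun _ ↦ (0 : ℝ) from
      hct.mono fun z hz ↦ perpProj_orthogonal hz v))
  rw [fderiv_bilin_apply hg hk1 (hV v), ← hVdef, hVy, ← hV', c] at perp
  simp only [fderiv_fun_const, Pi.zero_apply, _root_.zero_apply] at perp
  have geov : g y (fderiv ℝ k y (k y)) v + g y (Γ y (k y) (k y)) v = 0 := by
    have := congrArg (fun p ↦ g y p v) geo0
    simpa [nablaVec_apply, hv] using this
  have hz : g y (k y) (Γ y (k y) v + V') = 0 := by
    rw [map_add]; linarith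
  -- Both v and ∇_k V are orthogonal to k, so the polarised expansion equation cancels every term
  -- containing ∇_k V.
  have hzv := hρ0 v _ hv hz
  rw [c, c] at e
  -- assemble
  have hR := curv_apply_eq h hk.contDiff (k y) v
  have hgR := congrArg (fun p ↦ g y p v) hR
  have hdg := congrArg (fun p ↦ g y p v) (dgeo v)
  have hBB : g y (nablaVec Γ k y (nablaVec Γ k y v)) v
      = g y (nablaVec Γ k y (fderiv ℝ k y v)) v + g y (nablaVec Γ k y (Γ y v (k y))) v := by
    rw [nablaVec_apply Γ k y v]; simp
  have hvv := hρ0 v v hv hv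
  have hBv : g y (nablaVec Γ k y v) v = g y (fderiv ℝ k y v) v + g y (Γ y v (k y)) v := by
    rw [nablaVec_apply]; simp
  simp only [map_add, map_sub, map_smul, _root_.add_apply, _root_.sub_apply, _root_.smul_apply,
    smul_eq_mul, geo0, hv] at hgR hdg hzv e
  rw [hBB, hgR]
  rw [tf (k y) v] at *
  rw [s V' v] at *
  rw [s (Γ y v (k y)) v] at *
  linear_combination e - hdg + (-1) * hzv + lam y * hBv - (lam y / 2) * hvv

end Calculus

/-! ### Linear algebra of a nondegenerate form with a null vector and a skew form. -/

section Algebra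

variable {ι : Type*} [Fintype ι] [DecidableEq ι]

/-- The standard basis vectors of `ℝ^ι`. -/
abbrev stdVec (i : ι) : EuclideanSpace ℝ ι := EuclideanSpace.single i (1 : ℝ)

theorem eq_sum_stdVec (v : EuclideanSpace ℝ ι) : v = ∑ i, v i • stdVec i := by
  ext j
  simp [Pi.single_apply]

theorem clm_apply_eq_sum {F : Type*} [NormedAddCommGroup F] [NormedSpace ℝ F]
    (α : EuclideanSpace ℝ ι →L[ℝ] F) (v : EuclideanSpace ℝ ι) :
    α v = ∑ i, v i • α (stdVec i) := by
  conv_lhs => rw [eq_sum_stdVec v]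
  simp

theorem bilin_apply_eq_sum {F : Type*} [NormedAddCommGroup F] [NormedSpace ℝ F]
    (b : EuclideanSpace ℝ ι →L[ℝ] EuclideanSpace ℝ ι →L[ℝ] F) (v w : EuclideanSpace ℝ ι) :
    b v w = ∑ i, ∑ j, (v i * w j) • b (stdVec i) (stdVec j) := by
  rw [clm_apply_eq_sum b v, _root_.sum_apply]
  refine Finset.sum_congr rfl fun i _ ↦ ?_
  rw [_root_.smul_apply, clm_apply_eq_sum, Finset.smul_sum]
  simp [mul_smul]

/-- `gi` is the matrix inverse to the symmetric form `g`. -/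
structure IsInverseForm (g : EuclideanSpace ℝ ι →L[ℝ] EuclideanSpace ℝ ι →L[ℝ] ℝ)
    (gi : ι → ι → ℝ) : Prop where
  symm : ∀ v w, g v w = g w v
  inv_symm : ∀ i j, gi i j = gi j i
  inv_mul : ∀ i j, ∑ l, gi i l * g (stdVec l) (stdVec j) = if i = j then 1 else 0

variable {g : EuclideanSpace ℝ ι →L[ℝ] EuclideanSpace ℝ ι →L[ℝ] ℝ} {gi : ι → ι → ℝ}

theorem IsInverseForm.sum_inv_apply (h : IsInverseForm g gi) (j : ι) (x : EuclideanSpace ℝ ι) :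
    ∑ i, gi j i * g x (stdVec i) = x j := by
  have : ∀ i, gi j i * g x (stdVec i) = ∑ l, x l * (gi j i * g (stdVec i) (stdVec l)) := by
    intro i
    rw [h.symm, clm_apply_eq_sum, Finset.mul_sum]
    refine Finset.sum_congr rfl fun l _ ↦ ?_
    rw [smul_eq_mul]; ring
  simp_rw [this]
  rw [Finset.sum_comm]
  simp_rw [← Finset.mul_sum, h.inv_mul]
  simp

theorem IsInverseForm.sum_left (h : IsInverseForm g gi) (x : EuclideanSpace ℝ ι) (β : ι → ℝ) :
    ∑ i, ∑ j, gi i j * g x (stdVec i) * β j = ∑ j, x j * β j := by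
  rw [Finset.sum_comm]
  refine Finset.sum_congr rfl fun j _ ↦ ?_
  rw [← Finset.sum_mul, ← h.sum_inv_apply j x]
  simp_rw [h.inv_symm j]

theorem IsInverseForm.sum_right (h : IsInverseForm g gi) (x : EuclideanSpace ℝ ι) (β : ι → ℝ) :
    ∑ i, ∑ j, gi i j * β i * g x (stdVec j) = ∑ i, x i * β i := by
  refine Finset.sum_congr rfl fun i _ ↦ ?_
  rw [← h.sum_inv_apply i x, Finset.sum_mul]
  refine Finset.sum_congr rfl fun j _ ↦ by ring

theorem IsInverseForm.trace (h : IsInverseForm g gi) :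
    ∑ i, ∑ j, gi i j * g (stdVec i) (stdVec j) = Fintype.card ι := by
  have : ∀ i, ∑ j, gi i j * g (stdVec i) (stdVec j) = 1 := fun i ↦ by
    rw [h.sum_inv_apply]; simp
  simp [this]

/-- The endomorphism with `g (sharp F v) w = F v w`. -/
def sharp (gi : ι → ι → ℝ) (F : EuclideanSpace ℝ ι →L[ℝ] EuclideanSpace ℝ ι →L[ℝ] ℝ) :
    EuclideanSpace ℝ ι →L[ℝ] EuclideanSpace ℝ ι :=
  ∑ i, ∑ j, gi i j • (F.flip (stdVec j)).smulRight (stdVec i)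

theorem sharp_apply (gi : ι → ι → ℝ) (F : EuclideanSpace ℝ ι →L[ℝ] EuclideanSpace ℝ ι →L[ℝ] ℝ)
    (v : EuclideanSpace ℝ ι) :
    sharp gi F v = ∑ i, ∑ j, (gi i j * F v (stdVec j)) • stdVec i := by
  simp [sharp, mul_smul]

theorem IsInverseForm.sharp_left (h : IsInverseForm g gi)
    (F : EuclideanSpace ℝ ι →L[ℝ] EuclideanSpace ℝ ι →L[ℝ] ℝ) (v w : EuclideanSpace ℝ ι) :
    g (sharp gi F v) w = F v w := by
  rw [sharp_apply, h.symm]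
  simp only [map_sum, map_smul, smul_eq_mul]
  rw [clm_apply_eq_sum (F v) w]
  simp only [smul_eq_mul]
  rw [← h.sum_left]
  exact Finset.sum_congr rfl fun i _ ↦ Finset.sum_congr rfl fun j _ ↦ by ring

theorem apply_sharp (gi : ι → ι → ℝ)
    (F : EuclideanSpace ℝ ι →L[ℝ] EuclideanSpace ℝ ι →L[ℝ] ℝ)
    (α : EuclideanSpace ℝ ι →L[ℝ] ℝ) (v : EuclideanSpace ℝ ι) :
    α (sharp gi F v) = ∑ i, ∑ j, gi i j * α (stdVec i) * F v (stdVec j) := by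
  rw [sharp_apply]
  simp only [map_sum, map_smul, smul_eq_mul]
  exact Finset.sum_congr rfl fun i _ ↦ Finset.sum_congr rfl fun j _ ↦ by ring

/-- `F_{ij} F^{ij}`. -/
def normSqForm (gi : ι → ι → ℝ) (F : EuclideanSpace ℝ ι →L[ℝ] EuclideanSpace ℝ ι →L[ℝ] ℝ) : ℝ :=
  ∑ i, ∑ j, gi i j * F (stdVec i) (sharp gi F (stdVec j))

/-- If a symmetric form `Q` annihilates the null vector `k`, and is a multiple of `g` minus the
square of a skew form `F` on `k^⊥`, then its trace determines the multiple. -/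
theorem IsInverseForm.eq_on_perp (h : IsInverseForm g gi) {n : ℕ} (hn : n ≠ 0)
    (hcard : Fintype.card ι = n + 2)
    {F Q : EuclideanSpace ℝ ι →L[ℝ] EuclideanSpace ℝ ι →L[ℝ] ℝ} {k t : EuclideanSpace ℝ ι}
    {μ σ r : ℝ} (hF : ∀ v w, F v w = -F w v) (hFk : ∀ v, F k v = μ * g k v)
    (hk : g k k = 0) (ht : g k t ≠ 0) (hQ : ∀ v w, Q v w = Q w v) (hQk : ∀ v, Q k v = 0)
    (hQtr : ∑ i, ∑ j, gi i j * Q (stdVec i) (stdVec j) = -r)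
    (hQp : ∀ v, g k v = 0 → Q v v = σ * g v v - F v (sharp gi F v))
    (v w : EuclideanSpace ℝ ι) (hv : g k v = 0) (hw : g k w = 0) :
    Q v w + r / n * g v w
      = (normSqForm gi F + 2 * μ ^ 2) / n * g v w - F v (sharp gi F w) := by
  have Hs : ∀ v w, F v (sharp gi F w) = F w (sharp gi F v) := fun v w ↦ by
    rw [← h.sharp_left F v, ← h.sharp_left F w, h.symm]
  have pol : ∀ v w, g k v = 0 → g k w = 0 → Q v w = σ * g v w - F v (sharp gi F w) := by
    intro v w hv hw
    have h1 := hQp (v + w) (by simp [hv, hw])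
    simp only [map_add, _root_.add_apply] at h1
    rw [hQ w v, h.symm w v, Hs w v, hQp v hv, hQp w hw] at h1
    linarith
  -- Normalised so that κ(t') = 1; then x - κ(x) t' is the projection of x to k^⊥.
  set t' := (g k t)⁻¹ • t with ht'
  have hkt : g k t' = 1 := by simp [ht', ht]
  -- the remainder `Z` vanishes on `k^⊥`
  set Z : EuclideanSpace ℝ ι → EuclideanSpace ℝ ι → ℝ :=
    fun v w ↦ Q v w - σ * g v w + F v (sharp gi F w) with hZ
  -- A symmetric form vanishing on the kernel of κ is κ ⊗ α + α ⊗ κ, here with α = Z(t', ·) - ½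
  -- Z(t', t') κ. Its trace is 2 α(k), which is 2 Z(t', k) because κ(k) = 0.
  have Zdec : ∀ x y, Z x y = g k x * (Z t' y - Z t' t' / 2 * g k y)
      + g k y * (Z t' x - Z t' t' / 2 * g k x) := by
    intro x y
    have h0 := pol (x - g k x • t') (y - g k y • t') (by simp [hkt]) (by simp [hkt])
    simp only [map_sub, map_smul, _root_.sub_apply, _root_.smul_apply, smul_eq_mul] at h0
    simp only [hZ]
    rw [hQ t' x, h.symm t' x, Hs t' x]
    linear_combination h0
  have Zlin : ∀ x, Z t' x = ∑ j, x j * Z t' (stdVec j) := by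
    intro x
    simp only [hZ]
    conv_lhs => rw [clm_apply_eq_sum (Q t') x, clm_apply_eq_sum (g t') x, clm_apply_eq_sum
      (sharp gi F) x]
    simp only [map_sum, map_smul, smul_eq_mul, mul_add, mul_sub, Finset.sum_add_distrib,
      Finset.sum_sub_distrib, Finset.mul_sum]
    congr 2
    exact Finset.sum_congr rfl fun j _ ↦ by ring
  have ksum : ∑ j, k j * g k (stdVec j) = 0 := by
    rw [← hk]; exact (clm_apply_eq_sum (g k) k).symm
  have trZ : ∑ i, ∑ j, gi i j * Z (stdVec i) (stdVec j) = 2 * Z t' k := by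
    have e : ∀ i j, gi i j * Z (stdVec i) (stdVec j)
        = gi i j * g k (stdVec i) * (Z t' (stdVec j) - Z t' t' / 2 * g k (stdVec j))
        + gi i j * (Z t' (stdVec i) - Z t' t' / 2 * g k (stdVec i)) * g k (stdVec j) := by
      intro i j
      rw [Zdec (stdVec i)]; ring
    simp_rw [e, Finset.sum_add_distrib]
    rw [h.sum_left, h.sum_right]
    have : ∑ j, k j * (Z t' (stdVec j) - Z t' t' / 2 * g k (stdVec j)) = Z t' k := by
      rw [Zlin k]
      simp_rw [mul_sub, Finset.sum_sub_distrib, mul_left_comm (k _) (Z t' t' / 2),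
        ← Finset.mul_sum, ksum]
      ring
    rw [this]; ring
  have trZ' : ∑ i, ∑ j, gi i j * Z (stdVec i) (stdVec j) = -r - σ * (n + 2) + normSqForm gi F := by
    have e : ∀ i j, gi i j * Z (stdVec i) (stdVec j) = gi i j * Q (stdVec i) (stdVec j)
        - σ * (gi i j * g (stdVec i) (stdVec j))
        + gi i j * F (stdVec i) (sharp gi F (stdVec j)) := fun i j ↦ by simp only [hZ]; ring
    simp_rw [e, Finset.sum_add_distrib, Finset.sum_sub_distrib, ← Finset.mul_sum]
    rw [hQtr, h.trace, hcard, normSqForm]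
    push_cast; ring
  -- Evaluating Z(t', k) directly and comparing the two expressions for the trace turns the
  -- coefficient n + 2 of σ into n, so the equation can be solved for σ.
  have Ztk : Z t' k = -σ - μ ^ 2 := by
    have e1 : F t' (sharp gi F k) = -μ ^ 2 := by
      rw [Hs, hFk, h.symm k, h.sharp_left, hF, hFk, hkt]; ring
    simp only [hZ]
    rw [hQ, hQk, h.symm, hkt, e1]; ring
  have hσ : n * σ = normSqForm gi F + 2 * μ ^ 2 - r := by
    rw [trZ, Ztk] at trZ'
    linarith
  have hn' : (n : ℝ) ≠ 0 := by exact_mod_cast hn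
  have : σ = (normSqForm gi F + 2 * μ ^ 2 - r) / n := by field_simp; linarith
  rw [pol v w hv hw, this]
  ring

/-- `κ_a F_{bc} + κ_b F_{ca} + κ_c F_{ab}` with `κ = g(k, ·)`. -/
def wedgeForm (g F : EuclideanSpace ℝ ι →L[ℝ] EuclideanSpace ℝ ι →L[ℝ] ℝ)
    (k : EuclideanSpace ℝ ι) (a b c : ι) : ℝ :=
  g k (stdVec a) * F (stdVec b) (stdVec c) + g k (stdVec b) * F (stdVec c) (stdVec a)
    + g k (stdVec c) * F (stdVec a) (stdVec b)

/-- The generator of `k^⊥` given by `κ_a e_b - κ_b e_a`. -/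
def perpVec (g : EuclideanSpace ℝ ι →L[ℝ] EuclideanSpace ℝ ι →L[ℝ] ℝ)
    (k : EuclideanSpace ℝ ι) (a b : ι) : EuclideanSpace ℝ ι :=
  g k (stdVec a) • stdVec b - g k (stdVec b) • stdVec a

omit [Fintype ι] in
theorem perpVec_orthogonal (k : EuclideanSpace ℝ ι) (a b : ι) : g k (perpVec g k a b) = 0 := by
  simp [perpVec]; ring

/-- As a covector in its free slot, each factor is ±F(p, ·) plus a multiple of κ, with p in k^⊥. The
cross terms vanish because F(p, k) = -μ κ(p) = 0, and the last term because κ(k) = 0. -/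
theorem IsInverseForm.sum_wedge_wedge (h : IsInverseForm g gi)
    {F : EuclideanSpace ℝ ι →L[ℝ] EuclideanSpace ℝ ι →L[ℝ] ℝ} {k : EuclideanSpace ℝ ι} {μ : ℝ}
    (hF : ∀ v w, F v w = -F w v) (hFk : ∀ v, F k v = μ * g k v) (hk : g k k = 0) (a b c d : ι) :
    ∑ i, ∑ j, gi i j * wedgeForm g F k a b i * wedgeForm g F k j c d
      = -F (perpVec g k a b) (sharp gi F (perpVec g k d c)) := by
  have e1 : ∀ i, wedgeForm g F k a b i
      = F (perpVec g k a b) (stdVec i) + F (stdVec a) (stdVec b) * g k (stdVec i) := by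
    intro i
    simp only [wedgeForm, perpVec, map_sub, map_smul, _root_.sub_apply, _root_.smul_apply,
      smul_eq_mul]
    rw [hF (stdVec i) (stdVec a)]; ring
  have e2 : ∀ j, wedgeForm g F k j c d
      = -F (perpVec g k d c) (stdVec j) + F (stdVec c) (stdVec d) * g k (stdVec j) := by
    intro j
    simp only [wedgeForm, perpVec, map_sub, map_smul, _root_.sub_apply, _root_.smul_apply,
      smul_eq_mul]
    rw [hF (stdVec c) (stdVec j)]; ring
  have hFp : ∀ a b, F (perpVec g k a b) k = 0 := fun a b ↦ by
    rw [hF, hFk, perpVec_orthogonal]; ring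
  have s0 : ∀ v : EuclideanSpace ℝ ι, ∑ i, v i * g k (stdVec i) = g k v := fun v ↦
    (clm_apply_eq_sum (g k) v).symm
  have s1 : ∀ v : EuclideanSpace ℝ ι, ∑ i, k i * F v (stdVec i) = F v k := fun v ↦
    (clm_apply_eq_sum (F v) k).symm
  have e : ∀ i j, gi i j * wedgeForm g F k a b i * wedgeForm g F k j c d =
      -(gi i j * F (perpVec g k a b) (stdVec i) * F (perpVec g k d c) (stdVec j))
      + F (stdVec c) (stdVec d) * (gi i j * F (perpVec g k a b) (stdVec i) * g k (stdVec j))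
      - F (stdVec a) (stdVec b) * (gi i j * g k (stdVec i) * F (perpVec g k d c) (stdVec j))
      + F (stdVec a) (stdVec b) * F (stdVec c) (stdVec d) *
        (gi i j * g k (stdVec i) * g k (stdVec j)) := by
    intro i j
    rw [e1, e2]; ring
  simp_rw [e, Finset.sum_add_distrib, Finset.sum_sub_distrib, Finset.sum_add_distrib,
    ← Finset.mul_sum, Finset.sum_neg_distrib]
  rw [h.sum_right, h.sum_left, h.sum_left, s0, s1, s1, hFp, hFp, hk, apply_sharp]
  ring

/-- One contraction is `sum_wedge_wedge`; tracing it produces |F|² and two terms F(k, F♯ ·) = -μ² κ.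
They add up to the very coefficient that `eq_on_perp` puts in front of g. -/
theorem IsInverseForm.sum_wedge_sq (h : IsInverseForm g gi)
    {F : EuclideanSpace ℝ ι →L[ℝ] EuclideanSpace ℝ ι →L[ℝ] ℝ} {k : EuclideanSpace ℝ ι} {μ : ℝ}
    (hF : ∀ v w, F v w = -F w v) (hFk : ∀ v, F k v = μ * g k v) (hk : g k k = 0) (a d : ι) :
    ∑ i, ∑ j, ∑ p, ∑ q, gi i p * gi j q * wedgeForm g F k a p q * wedgeForm g F k d i j
      = (normSqForm gi F + 2 * μ ^ 2) * (g k (stdVec a) * g k (stdVec d)) := by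
  have cyc : ∀ b c d, wedgeForm g F k b c d = wedgeForm g F k d b c := fun b c d ↦ by
    simp only [wedgeForm]; ring
  have inner : ∀ i p, ∑ j, ∑ q, gi i p * gi j q * wedgeForm g F k a p q * wedgeForm g F k d i j
      = gi i p * -F (perpVec g k a p) (sharp gi F (perpVec g k i d)) := by
    intro i p
    rw [← h.sum_wedge_wedge hF hFk hk, Finset.sum_comm, Finset.mul_sum]
    refine Finset.sum_congr rfl fun q _ ↦ ?_
    rw [Finset.mul_sum]
    refine Finset.sum_congr rfl fun j _ ↦ ?_
    rw [cyc d i j, h.inv_symm j q]; ring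
  have e : ∀ i p, gi i p * -F (perpVec g k a p) (sharp gi F (perpVec g k i d))
      = g k (stdVec a) * g k (stdVec d) * (gi p i * F (stdVec p) (sharp gi F (stdVec i)))
      - g k (stdVec a) * (gi i p * g k (stdVec i) * F (stdVec p) (sharp gi F (stdVec d)))
      - g k (stdVec d) * (gi i p * F (stdVec a) (sharp gi F (stdVec i)) * g k (stdVec p))
      + F (stdVec a) (sharp gi F (stdVec d)) * (gi i p * g k (stdVec i) * g k (stdVec p)) := by
    intro i p
    simp only [perpVec, map_sub, map_smul, _root_.sub_apply, _root_.smul_apply, smul_eq_mul]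
    rw [h.inv_symm p i]; ring
  have s0 : ∑ i, k i * g k (stdVec i) = 0 := by
    rw [← hk]; exact (clm_apply_eq_sum (g k) k).symm
  have Fk : ∀ v, F k (sharp gi F v) = -μ ^ 2 * g k v := fun v ↦ by
    rw [hFk, h.symm, h.sharp_left, hF, hFk]; ring
  have s1 : ∑ p, k p * F (stdVec p) (sharp gi F (stdVec d)) = -μ ^ 2 * g k (stdVec d) := by
    rw [← Fk, clm_apply_eq_sum F k]; simp
  have s2 : ∑ i, k i * F (stdVec a) (sharp gi F (stdVec i)) = -μ ^ 2 * g k (stdVec a) := by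
    rw [← Fk, ← h.sharp_left, h.symm, h.sharp_left, clm_apply_eq_sum (sharp gi F) k]; simp
  calc _ = ∑ i, ∑ p, gi i p * -F (perpVec g k a p) (sharp gi F (perpVec g k i d)) := by
        refine Finset.sum_congr rfl fun i _ ↦ ?_
        rw [Finset.sum_comm]
        exact Finset.sum_congr rfl fun p _ ↦ inner i p
    _ = _ := by
        simp_rw [e, Finset.sum_add_distrib, Finset.sum_sub_distrib, ← Finset.mul_sum]
        rw [h.sum_left, h.sum_left, h.sum_right, s0, s1, s2, Finset.sum_comm, ← normSqForm]
        ring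

end Algebra

/-! ### From component functions to forms, Christoffel maps and curvature. -/

section Components

variable {n : ℕ}

/-- The bilinear map with components `T a b`. -/
def bilinOf {ι F : Type*} [Fintype ι] [DecidableEq ι] [NormedAddCommGroup F] [NormedSpace ℝ F]
    (T : ι → ι → F) : EuclideanSpace ℝ ι →L[ℝ] EuclideanSpace ℝ ι →L[ℝ] F :=
  ∑ a, ∑ b, (EuclideanSpace.proj a : EuclideanSpace ℝ ι →L[ℝ] ℝ).smulRight
    ((EuclideanSpace.proj b : EuclideanSpace ℝ ι →L[ℝ] ℝ).smulRight (T a b))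

theorem bilinOf_apply {ι F : Type*} [Fintype ι] [DecidableEq ι] [NormedAddCommGroup F]
    [NormedSpace ℝ F] (T : ι → ι → F) (v w : EuclideanSpace ℝ ι) :
    bilinOf T v w = ∑ a, ∑ b, (v a * w b) • T a b := by
  simp [bilinOf, mul_smul]

theorem bilinOf_stdVec {ι F : Type*} [Fintype ι] [DecidableEq ι] [NormedAddCommGroup F]
    [NormedSpace ℝ F] (T : ι → ι → F) (a b : ι) : bilinOf T (stdVec a) (stdVec b) = T a b := by
  rw [bilinOf_apply, Finset.sum_eq_single a, Finset.sum_eq_single b] <;> simp +contextual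

theorem contDiffAt_bilinOf {ι F X : Type*} [Fintype ι] [DecidableEq ι] [NormedAddCommGroup F]
    [NormedSpace ℝ F] [NormedAddCommGroup X] [NormedSpace ℝ X] {m : ℕ∞ω} {T : ι → ι → X → F}
    {y : X} (h : ∀ a b, ContDiffAt ℝ m (T a b) y) :
    ContDiffAt ℝ m (fun z ↦ bilinOf fun a b ↦ T a b z) y := by
  unfold bilinOf
  refine ContDiffAt.sum fun a _ ↦ ContDiffAt.sum fun b _ ↦ ?_
  exact contDiffAt_const.smulRight (contDiffAt_const.smulRight (h a b))

/-- The metric with components `G a b`. -/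
def formOf (G : Fin (n + 2) → Fin (n + 2) → Model n → ℝ) (z : Model n) :
    Model n →L[ℝ] Model n →L[ℝ] ℝ :=
  bilinOf fun a b ↦ G a b z

/-- The Christoffel map of the metric with components `G a b`. -/
def chrisMap (G : Fin (n + 2) → Fin (n + 2) → Model n → ℝ) (z : Model n) :
    Model n →L[ℝ] Model n →L[ℝ] Model n :=
  bilinOf fun a b ↦ WithLp.toLp 2 fun c ↦ christoffel G c a b z

variable {G : Fin (n + 2) → Fin (n + 2) → Model n → ℝ} {y : Model n}

theorem formOf_stdVec (G : Fin (n + 2) → Fin (n + 2) → Model n → ℝ) (z : Model n)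
    (a b : Fin (n + 2)) : formOf G z (stdVec a) (stdVec b) = G a b z :=
  bilinOf_stdVec _ a b

theorem chrisMap_stdVec (G : Fin (n + 2) → Fin (n + 2) → Model n → ℝ) (z : Model n)
    (a b c : Fin (n + 2)) : chrisMap G z (stdVec a) (stdVec b) c = christoffel G c a b z := by
  rw [chrisMap, bilinOf_stdVec]

/-- Near `y`, the functions `G a b` are the components of a smooth metric. -/
structure IsMetricAt (G : Fin (n + 2) → Fin (n + 2) → Model n → ℝ) (y : Model n) : Prop where
  contDiff : ∀ a b, ContDiffAt ℝ ∞ (G a b) y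
  symm : ∀ᶠ z in 𝓝 y, ∀ a b, G a b z = G b a z
  det_ne_zero : ∀ᶠ z in 𝓝 y, (Matrix.of fun i j ↦ G i j z).det ≠ 0

theorem contDiffAt_det {X ι : Type*} [Fintype ι] [DecidableEq ι] [NormedAddCommGroup X]
    [NormedSpace ℝ X] {m : ℕ∞ω} {A : X → Matrix ι ι ℝ} {y : X}
    (h : ∀ i j, ContDiffAt ℝ m (fun z ↦ A z i j) y) : ContDiffAt ℝ m (fun z ↦ (A z).det) y := by
  simp only [Matrix.det_apply]
  exact ContDiffAt.sum fun σ _ ↦ (contDiffAt_prod fun i _ ↦ h _ _).const_smul _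

theorem contDiffAt_matrix_inv {X ι : Type*} [Fintype ι] [DecidableEq ι] [NormedAddCommGroup X]
    [NormedSpace ℝ X] {m : ℕ∞ω} {A : X → Matrix ι ι ℝ} {y : X}
    (h : ∀ i j, ContDiffAt ℝ m (fun z ↦ A z i j) y) (hy : (A y).det ≠ 0) (i j : ι) :
    ContDiffAt ℝ m (fun z ↦ (A z)⁻¹ i j) y := by
  simp only [Matrix.inv_def, Matrix.smul_apply, Ring.inverse_eq_inv', smul_eq_mul,
    Matrix.adjugate_apply]
  refine ((contDiffAt_det h).inv hy).mul (contDiffAt_det fun a b ↦ ?_)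
  -- An adjugate entry is a determinant with row j replaced by a basis vector, so its entries are
  -- either constant or entries of A.
  by_cases hab : a = j
  · subst hab; simp only [Matrix.updateRow_self]; exact contDiffAt_const
  · simp only [Matrix.updateRow_ne hab]; exact h a b

theorem contDiffAt_pd {f : Model n → ℝ} (hf : ContDiffAt ℝ ∞ f y) (a : Fin (n + 2)) :
    ContDiffAt ℝ ∞ (pd a f) y :=
  (hf.fderiv_right (m := ∞) (by simp)).clm_apply contDiffAt_const

theorem contDiffAt_christoffel (h : IsMetricAt G y) (c a b : Fin (n + 2)) :
    ContDiffAt ℝ ∞ (christoffel G c a b) y := by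
  unfold christoffel
  refine contDiffAt_const.mul (ContDiffAt.sum fun d _ ↦ ?_)
  refine (contDiffAt_matrix_inv (A := fun z ↦ Matrix.of fun i j ↦ G i j z) h.contDiff
    h.det_ne_zero.self_of_nhds c d).mul ?_
  exact ((contDiffAt_pd (h.contDiff _ _) _).add (contDiffAt_pd (h.contDiff _ _) _)).sub
    (contDiffAt_pd (h.contDiff _ _) _)

theorem contDiffAt_formOf (h : IsMetricAt G y) : ContDiffAt ℝ ∞ (formOf G) y :=
  contDiffAt_bilinOf h.contDiff

theorem contDiffAt_chrisMap (h : IsMetricAt G y) : ContDiffAt ℝ ∞ (chrisMap G) y := by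
  refine contDiffAt_bilinOf (T := fun a b z ↦ WithLp.toLp 2 fun c ↦ christoffel G c a b z)
    fun a b ↦ ?_
  rw [contDiffAt_euclidean]
  exact fun c ↦ contDiffAt_christoffel h c a b

theorem formOf_symm {z : Model n} (h : ∀ a b, G a b z = G b a z) (v w : Model n) :
    formOf G z v w = formOf G z w v := by
  rw [formOf, bilinOf_apply, bilinOf_apply, Finset.sum_comm]
  refine Finset.sum_congr rfl fun i _ ↦ Finset.sum_congr rfl fun j _ ↦ ?_
  rw [h j i, mul_comm]

theorem isInverseForm_invG {z : Model n} (h : ∀ a b, G a b z = G b a z)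
    (hdet : (Matrix.of fun i j ↦ G i j z).det ≠ 0) :
    IsInverseForm (formOf G z) fun i j ↦ invG G i j z where
  symm := formOf_symm h
  inv_symm i j := by
    have ht : (Matrix.of fun i j ↦ G i j z).transpose = Matrix.of fun i j ↦ G i j z := by
      ext a b; exact h b a
    have := congrFun (congrFun (Matrix.transpose_nonsing_inv (Matrix.of fun i j ↦ G i j z)) j) i
    rw [ht] at this
    exact this
  inv_mul i j := by
    have := congrFun (congrFun (Matrix.nonsing_inv_mul (Matrix.of fun i j ↦ G i j z)
      (isUnit_iff_ne_zero.2 hdet)) i) j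
    rw [Matrix.mul_apply, Matrix.one_apply] at this
    simp_rw [formOf_stdVec]
    exact this

theorem formOf_nondegenerate {z : Model n} (h : IsInverseForm (formOf G z) fun i j ↦ invG G i j z)
    (p : Model n) (hp : ∀ x, formOf G z p x = 0) : p = 0 := by
  ext j
  rw [← h.sum_inv_apply j p]
  simp [hp]

theorem fderiv_formOf_stdVec {z : Model n} (h : DifferentiableAt ℝ (formOf G) z)
    (c a b : Fin (n + 2)) : fderiv ℝ (formOf G) z (stdVec c) (stdVec a) (stdVec b)
      = pd c (G a b) z := by
  rw [← fderiv_bilin_const h]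
  simp only [formOf_stdVec]
  rfl

theorem formOf_chrisMap_stdVec {z : Model n}
    (h : IsInverseForm (formOf G z) fun i j ↦ invG G i j z) (a b c : Fin (n + 2)) :
    formOf G z (chrisMap G z (stdVec a) (stdVec b)) (stdVec c)
      = (1 / 2) * (pd a (G b c) z + pd b (G a c) z - pd c (G a b) z) := by
  have e := h.sum_left (stdVec c)
    fun d ↦ (1 / 2) * (pd a (G b d) z + pd b (G a d) z - pd d (G a b) z)
  rw [h.symm, clm_apply_eq_sum]
  simp only [chrisMap_stdVec, christoffel, smul_eq_mul]
  trans ∑ j, (stdVec c : Model n) j *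
    ((1 / 2) * (pd a (G b j) z + pd b (G a j) z - pd j (G a b) z))
  · rw [← e]
    refine Finset.sum_congr rfl fun i _ ↦ ?_
    rw [Finset.mul_sum, Finset.sum_mul]
    exact Finset.sum_congr rfl fun j _ ↦ by ring
  · rw [Finset.sum_eq_single c] <;> simp +contextual

/-- On basis vectors the two Christoffel symbols of the first kind add up to a single partial
derivative; linearity in each slot does the rest. -/
theorem formOf_compat {z : Model n} (hd : DifferentiableAt ℝ (formOf G) z)
    (hs : ∀ᶠ z in 𝓝 z, ∀ a b, G a b z = G b a z)
    (h : IsInverseForm (formOf G z) fun i j ↦ invG G i j z) (u v w : Model n) :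
    fderiv ℝ (formOf G) z u v w
      = formOf G z (chrisMap G z u v) w + formOf G z v (chrisMap G z u w) := by
  have h0 : ∀ c a b, fderiv ℝ (formOf G) z (stdVec c) (stdVec a) (stdVec b)
      = formOf G z (chrisMap G z (stdVec c) (stdVec a)) (stdVec b)
        + formOf G z (stdVec a) (chrisMap G z (stdVec c) (stdVec b)) := by
    intro c a b
    have hpd : ∀ c a b, pd c (G a b) z = pd c (G b a) z := fun c a b ↦ by
      have : G a b =ᶠ[𝓝 z] G b a := hs.mono fun z hz ↦ hz a b
      simp only [pd, this.fderiv_eq]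
    rw [fderiv_formOf_stdVec hd, h.symm (stdVec a), formOf_chrisMap_stdVec h,
      formOf_chrisMap_stdVec h, hpd c b a, hpd b c a, hpd a c b]
    ring
  have h1 : ∀ c a w, fderiv ℝ (formOf G) z (stdVec c) (stdVec a) w
      = formOf G z (chrisMap G z (stdVec c) (stdVec a)) w
        + formOf G z (stdVec a) (chrisMap G z (stdVec c) w) := by
    intro c a w
    rw [eq_sum_stdVec w]
    simp only [map_sum, map_smul, h0, smul_add, Finset.sum_add_distrib]
  have h2 : ∀ c v w, fderiv ℝ (formOf G) z (stdVec c) v w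
      = formOf G z (chrisMap G z (stdVec c) v) w + formOf G z v (chrisMap G z (stdVec c) w) := by
    intro c v w
    rw [eq_sum_stdVec v]
    simp only [map_sum, map_smul, h1, smul_add, Finset.sum_add_distrib, _root_.sum_apply,
      _root_.smul_apply]
  rw [eq_sum_stdVec u]
  simp only [map_sum, map_smul, h2, smul_add, Finset.sum_add_distrib, _root_.sum_apply,
    _root_.smul_apply]

theorem chrisMap_torsionFree {z : Model n} (hs : ∀ᶠ z in 𝓝 z, ∀ a b, G a b z = G b a z)
    (v w : Model n) : chrisMap G z v w = chrisMap G z w v := by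
  rw [chrisMap, bilinOf_apply, bilinOf_apply, Finset.sum_comm]
  refine Finset.sum_congr rfl fun i _ ↦ Finset.sum_congr rfl fun j _ ↦ ?_
  rw [mul_comm]
  congr 3
  ext c
  have : G i j =ᶠ[𝓝 z] G j i := hs.mono fun z hz ↦ hz i j
  simp only [christoffel, pd, this.fderiv_eq]
  congr 1
  exact Finset.sum_congr rfl fun d _ ↦ by ring

theorem isLeviCivita_chrisMap (h : IsMetricAt G y) :
    IsLeviCivita (formOf G) (chrisMap G) y where
  contDiff := contDiffAt_infty.1 (contDiffAt_formOf h) 2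
  differentiable := (contDiffAt_chrisMap h).differentiableAt (by simp)
  symm := h.symm.mono fun z hz ↦ formOf_symm hz
  torsionFree := h.symm.eventually_nhds.mono fun z hz ↦ chrisMap_torsionFree hz
  compat := by
    have hd : ∀ᶠ z in 𝓝 y, DifferentiableAt ℝ (formOf G) z :=
      (((contDiffAt_formOf h).of_le (m := 1) (by exact_mod_cast le_top)).eventually
        -- Smoothness is lowered to a finite order first, since only then does it spread from y to
        -- nearby points.
        (by norm_num)).mono fun z hz ↦ hz.differentiableAt (by norm_num)
    filter_upwards [hd, h.symm.eventually_nhds, h.det_ne_zero] with z h1 h2 h3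
    exact formOf_compat h1 h2 (isInverseForm_invG h2.self_of_nhds h3)

theorem curv_stdVec (h : IsMetricAt G y) (a b c d : Fin (n + 2)) :
    curv (chrisMap G) y (stdVec a) (stdVec b) (stdVec d) c = riemann G a b c d y := by
  have hd : DifferentiableAt ℝ (chrisMap G) y := (contDiffAt_chrisMap h).differentiableAt (by simp)
  have h1 : ∀ a b d, fderiv ℝ (chrisMap G) y (stdVec a) (stdVec b) (stdVec d) c
      = pd a (christoffel G c b d) y := by
    intro a b d
    have hc : DifferentiableAt ℝ (fun z ↦ chrisMap G z (stdVec b) (stdVec d)) y :=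
      (hd.clm_apply (by fun_prop)).clm_apply (by fun_prop)
    rw [← fderiv_bilin_const hd, pd]
    have := ((EuclideanSpace.proj c : Model n →L[ℝ] ℝ).hasFDerivAt.comp y hc.hasFDerivAt).fderiv
    have e : (⇑(EuclideanSpace.proj c : Model n →L[ℝ] ℝ) ∘
        fun z ↦ chrisMap G z (stdVec b) (stdVec d)) = christoffel G c b d := by
      ext z; exact chrisMap_stdVec G z b d c
    rw [e] at this
    rw [this]
    rfl
  have h2 : ∀ a b d, chrisMap G y (stdVec a) (chrisMap G y (stdVec b) (stdVec d)) c
      = ∑ e, christoffel G c a e y * christoffel G e b d y := by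
    intro a b d
    rw [clm_apply_eq_sum]
    simp [chrisMap_stdVec, mul_comm]
  simp only [curv, riemann, PiLp.add_apply, PiLp.sub_apply, h1, h2, Finset.sum_sub_distrib]
  ring

end Components

/-! ### The tidal form on k^⊥. -/

section Identity

/-- The bilinear form `(v, w) ↦ g(R(v, k) w, k)`. -/
def tidalForm {E : Type*} [NormedAddCommGroup E] [NormedSpace ℝ E]
    (g : E →L[ℝ] E →L[ℝ] ℝ) (Γ : E → E →L[ℝ] E →L[ℝ] E) (y k : E) : E →L[ℝ] E →L[ℝ] ℝ :=
  (ContinuousLinearMap.compL ℝ E E ℝ (g.flip k)).comp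
    ((fderiv ℝ Γ y).flip k - fderiv ℝ Γ y k + (Γ y).bilinearComp (.id ℝ E) (Γ y k)
      - (ContinuousLinearMap.compL ℝ E E E (Γ y k)).comp (Γ y))

theorem tidalForm_apply {E : Type*} [NormedAddCommGroup E] [NormedSpace ℝ E]
    (g : E →L[ℝ] E →L[ℝ] ℝ) (Γ : E → E →L[ℝ] E →L[ℝ] E) (y k v w : E) :
    tidalForm g Γ y k v w = g (curv Γ y v k w) k := rfl

/-- The skew part of `(v, w) ↦ g(B v, w)`. -/
def skewForm {E : Type*} [NormedAddCommGroup E] [NormedSpace ℝ E]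
    (g : E →L[ℝ] E →L[ℝ] ℝ) (B : E →L[ℝ] E) : E →L[ℝ] E →L[ℝ] ℝ :=
  (1 / 2 : ℝ) • (g.comp B - (g.comp B).flip)

theorem skewForm_apply {E : Type*} [NormedAddCommGroup E] [NormedSpace ℝ E]
    (g : E →L[ℝ] E →L[ℝ] ℝ) (B : E →L[ℝ] E) (v w : E) :
    skewForm g B v w = (g (B v) w - g (B w) v) / 2 := by
  simp only [skewForm, _root_.smul_apply, _root_.sub_apply, ContinuousLinearMap.comp_apply,
    ContinuousLinearMap.flip_apply, smul_eq_mul]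
  ring

theorem skewForm_skew {E : Type*} [NormedAddCommGroup E] [NormedSpace ℝ E]
    (g : E →L[ℝ] E →L[ℝ] ℝ) (B : E →L[ℝ] E) (v w : E) :
    skewForm g B v w = -skewForm g B w v := by
  rw [skewForm_apply, skewForm_apply]; ring

variable {n : ℕ} {G : Fin (n + 2) → Fin (n + 2) → Model n → ℝ} {y : Model n}
  {k : Model n → Model n}

theorem curv_sum_mid (Γ : Model n → Model n →L[ℝ] Model n →L[ℝ] Model n) (u v w : Model n) :
    curv Γ y u v w = ∑ j, v j • curv Γ y u (stdVec j) w := by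
  simp only [curv]
  conv_lhs => rw [eq_sum_stdVec v]
  simp only [map_sum, map_smul, _root_.sum_apply, _root_.smul_apply, smul_add, smul_sub,
    Finset.sum_add_distrib, Finset.sum_sub_distrib]

theorem curv_sum_last (Γ : Model n → Model n →L[ℝ] Model n →L[ℝ] Model n) (u v w : Model n) :
    curv Γ y u v w = ∑ j, w j • curv Γ y u v (stdVec j) := by
  simp only [curv]
  conv_lhs => rw [eq_sum_stdVec w]
  simp only [map_sum, map_smul, smul_add, smul_sub,
    Finset.sum_add_distrib, Finset.sum_sub_distrib]

theorem riemannLow_eq (h : IsMetricAt G y) (a b c d : Fin (n + 2)) :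
    riemannLow G a b c d y
      = formOf G y (stdVec c) (curv (chrisMap G) y (stdVec a) (stdVec b) (stdVec d)) := by
  rw [riemannLow, clm_apply_eq_sum]
  simp only [curv_stdVec h, formOf_stdVec, smul_eq_mul, mul_comm]

theorem sum_riemannLow (h : IsMetricAt G y) (k : Model n) (b c : Fin (n + 2)) :
    ∑ i, ∑ j, riemannLow G b i j c y * k i * k j
      = tidalForm (formOf G y) (chrisMap G) y k (stdVec b) (stdVec c) := by
  have s := formOf_symm h.symm.self_of_nhds
  rw [tidalForm_apply, curv_sum_mid]
  simp only [map_sum, _root_.sum_apply, map_smul, _root_.smul_apply, smul_eq_mul]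
  refine Finset.sum_congr rfl fun i _ ↦ ?_
  rw [clm_apply_eq_sum _ k, Finset.mul_sum]
  refine Finset.sum_congr rfl fun j _ ↦ ?_
  rw [riemannLow_eq h, s, smul_eq_mul]
  ring

/-- Presents Ric(k, k) as the trace of u ↦ R(u, k)k, the shape in which the trace of the tidal form
appears. -/
theorem sum_ricci (h : IsMetricAt G y) (k : Model n) :
    ∑ i, ∑ j, ricci G i j y * k i * k j = ∑ c, curv (chrisMap G) y (stdVec c) k k c := by
  have e : ∀ c, curv (chrisMap G) y (stdVec c) k k c
      = ∑ i, ∑ j, k i * k j * riemann G c i c j y := by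
    intro c
    rw [curv_sum_mid]
    simp_rw [curv_sum_last (chrisMap G) (stdVec c) (stdVec _) k]
    simp [Finset.mul_sum, curv_stdVec h, mul_assoc]
  simp_rw [e, ricci]
  rw [Finset.sum_comm (s := Finset.univ) (t := Finset.univ) (f := fun c i ↦ ∑ j, _)]
  refine Finset.sum_congr rfl fun i _ ↦ ?_
  rw [Finset.sum_comm]
  refine Finset.sum_congr rfl fun j _ ↦ ?_
  rw [Finset.sum_mul, Finset.sum_mul]
  exact Finset.sum_congr rfl fun c _ ↦ by ring

/-- The shear-free identity for the curvature restricted to `k^⊥`. -/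
theorem tidalForm_perp (h : IsMetricAt G y) (hk : IsShearFree (formOf G) k y) (hn : n ≠ 0) :
    ∃ μ : ℝ, (∀ v, skewForm (formOf G y) (nablaVec (chrisMap G) k y) (k y) v
        = μ * formOf G y (k y) v) ∧
      ∀ v w, formOf G y (k y) v = 0 → formOf G y (k y) w = 0 →
      tidalForm (formOf G y) (chrisMap G) y (k y) v w
        + (∑ i, ∑ j, ricci G i j y * k y i * k y j) / n * formOf G y v w
      = (normSqForm (fun i j ↦ invG G i j y)
          (skewForm (formOf G y) (nablaVec (chrisMap G) k y)) + 2 * μ ^ 2) / n * formOf G y v w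
        - skewForm (formOf G y) (nablaVec (chrisMap G) k y) v
          (sharp (fun i j ↦ invG G i j y)
            (skewForm (formOf G y) (nablaVec (chrisMap G) k y)) w) := by
  have hLC := isLeviCivita_chrisMap h
  have hI := isInverseForm_invG h.symm.self_of_nhds h.det_ne_zero.self_of_nhds
  obtain ⟨t, ht⟩ := hk.ne_zero
  have geo := (nablaVec_self hLC hk ht).self_of_nhds
  have hBk := (nablaVec_inner_self hLC hk).self_of_nhds
  have h0 := hk.null.self_of_nhds
  obtain ⟨ρ, hρ⟩ := (nablaVec_shear hLC hk).self_of_nhds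
  obtain ⟨σ, hσ⟩ := curv_shearFree hLC hk
  set g := formOf G y with hg
  set B := nablaVec (chrisMap G) k y with hB
  set F := skewForm g B with hF
  set gi : Fin (n + 2) → Fin (n + 2) → ℝ := fun i j ↦ invG G i j y with hgi
  set lam := g (B (k y)) t / g (k y) t
  -- In the skew part, g(∇_k k, v) contributes λ κ(v) and g(∇_v k, k) vanishes. A nonzero μ measures
  -- the failure of k to be affinely parametrised.
  have hFk : ∀ v, F (k y) v = lam / 2 * g (k y) v := by
    intro v
    rw [hF, skewForm_apply, hBk, geo]
    simp only [map_smul, _root_.smul_apply, smul_eq_mul]; ring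
  have sw : ∀ u v w x : Model n, g (curv (chrisMap G) y u v w) x
      = -g (curv (chrisMap G) y v u w) x := fun u v w x ↦ by
    rw [curv_swap]; simp
  have sk : ∀ u v w x : Model n, g (curv (chrisMap G) y u v w) x
      = -g (curv (chrisMap G) y u v x) w := fun u v w x ↦ by
    rw [hg, curv_skew hLC, hI.symm]
  have ps : ∀ u v w x : Model n, g (curv (chrisMap G) y u v w) x
      = g (curv (chrisMap G) y w x u) v := curv_pair_symm hLC
  refine ⟨lam / 2, hFk, fun v w hv hw ↦ ?_⟩
  -- The summand ρ² is the scalar part of B² when B is ρ + F♯ modulo k.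
  refine hI.eq_on_perp (t := t) (σ := σ + ρ ^ 2) hn (by simp) (skewForm_skew g B) hFk h0 ht
    (Q := tidalForm g (chrisMap G) y (k y)) ?_ ?_ ?_ ?_ v w hv hw
  · intro v w
    rw [tidalForm_apply, tidalForm_apply, ps, sw, sk, neg_neg]
  · intro v
    rw [tidalForm_apply]
    linarith [sw (k y) (k y) v (k y)]
  · rw [sum_ricci h, ← Finset.sum_neg_distrib]
    refine Finset.sum_congr rfl fun i _ ↦ ?_
    rw [← hI.sum_inv_apply i, ← Finset.sum_neg_distrib]
    refine Finset.sum_congr rfl fun j _ ↦ ?_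
    rw [tidalForm_apply, sk]
    ring
  · intro v hv
    set f := sharp gi F with hf
    have hfv : ∀ w, g (f v) w = F v w := hI.sharp_left F v
    have hfk : g (k y) (f v) = 0 := by
      rw [hI.symm, hfv, skewForm_skew, hFk, hv]; ring
    -- Zero shear means that the symmetric part of B on k^⊥ is ρ g, so this difference is orthogonal
    -- to k^⊥ and hence proportional to k.
    have hp := eq_smul_of_orthogonal (p := B v - f v - ρ • v)
      (formOf_nondegenerate hI) ht (fun x hx ↦ by
        have := hρ v x hv hx
        simp only [map_sub, map_smul, _root_.sub_apply, _root_.smul_apply, smul_eq_mul]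
        change g (B v) x - g (f v) x - ρ * g v x = 0
        rw [hfv, hF, skewForm_apply]; linarith)
    set cc := formOf G y (B v - f v - ρ • v) t / formOf G y (k y) t
    have hBv : B v = f v + ρ • v + cc • k y := by rw [← hp]; abel
    have h1 := hρ v v hv hv
    -- With F(v, v) = 0 this gives g(B F♯v, v) = -g(Bv, F♯v), hence g(B F♯v, v) = -F(v, F♯v): the
    -- cross terms of B² drop out.
    have h2 := hρ (f v) v hfk hv
    have h3 : F v (f v) = (g (B v) (f v) - g (B (f v)) v) / 2 := by rw [hF, skewForm_apply]
    rw [hfv, show F v v = 0 by linarith [skewForm_skew g B v v]] at h2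
    rw [tidalForm_apply, sw, sk, neg_neg]
    have h4 := hσ v hv
    have h5 : g (B (B v)) v = g (B (f v)) v + ρ * g (B v) v := by
      conv_lhs => rw [hBv]
      simp [geo, hv]
    linear_combination h4 + h5 + h3 + (1 / 2) * h2 + (ρ / 2) * h1

end Identity

/-! ### The Weyl identity in coordinates. -/

section CoordinateIdentity

variable {n : ℕ} {G : Fin (n + 2) → Fin (n + 2) → Model n → ℝ} {y : Model n}
  {k : Model n → Model n}

theorem lower_eq (G : Fin (n + 2) → Fin (n + 2) → Model n → ℝ) (k : Model n → Model n)
    (a : Fin (n + 2)) (z : Model n) :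
    lower G (fun a z ↦ k z a) a z = formOf G z (stdVec a) (k z) := by
  rw [lower, clm_apply_eq_sum]
  simp only [formOf_stdVec, smul_eq_mul, mul_comm]

theorem covDeriv_lower (h : IsMetricAt G y) (hk : DifferentiableAt ℝ k y) (a b : Fin (n + 2)) :
    covDeriv G (lower G fun a z ↦ k z a) a b y
      = formOf G y (nablaVec (chrisMap G) k y (stdVec a)) (stdVec b) := by
  have hLC := isLeviCivita_chrisMap h
  have hg : DifferentiableAt ℝ (formOf G) y := hLC.contDiff.differentiableAt (by norm_num)
  have s := formOf_symm h.symm.self_of_nhds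
  have e1 : pd a (lower G (fun a z ↦ k z a) b) y
      = fderiv ℝ (fun z ↦ formOf G z (stdVec b) (k z)) y (stdVec a) := by
    rw [pd]
    congr 2
    ext z
    exact lower_eq G k b z
  have e2 : ∑ c, christoffel G c a b y * lower G (fun a z ↦ k z a) c y
      = formOf G y (chrisMap G y (stdVec a) (stdVec b)) (k y) := by
    rw [clm_apply_eq_sum (formOf G y)]
    simp only [lower_eq, chrisMap_stdVec, _root_.sum_apply, _root_.smul_apply, smul_eq_mul]
  rw [covDeriv, e1, e2, fderiv_bilin_apply (X := fun _ ↦ stdVec b) hg (by fun_prop) hk,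
    hLC.compat.self_of_nhds, nablaVec_apply, map_add, _root_.add_apply,
    s (fderiv ℝ k y _), s (chrisMap G y (stdVec a) (k y))]
  simp
  ring

/-- Total skew-symmetrisation sees only the skew part of ∇κ, and the weight 1/6 against the factor 3
leaves the cyclic sum. -/
theorem twist_lower (h : IsMetricAt G y) (hk : DifferentiableAt ℝ k y) (a b c : Fin (n + 2)) :
    twist G (lower G fun a z ↦ k z a) a b c y
      = wedgeForm (formOf G y) (skewForm (formOf G y) (nablaVec (chrisMap G) k y)) (k y) a b c := by
  have s := formOf_symm h.symm.self_of_nhds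
  simp only [twist, skew₃, covDeriv_lower h hk, lower_eq, wedgeForm, skewForm_apply, s (k y)]
  ring

/-- The curvature identity of a shear-free null geodesic congruence, in coordinates. -/
theorem weyl_identity (h : IsMetricAt G y) (hk : IsShearFree (formOf G) k y) (hn : n ≠ 0)
    (a b c d : Fin (n + 2)) :
    let kc : Fin (n + 2) → Model n → ℝ := fun a z ↦ k z a
    let κ := lower G kc
    let τ := twist G κ
    4 * skew₂ (fun a b ↦ skew₂ (fun c d ↦
        κ a y * (∑ i, ∑ j, weyl G b i j c y * kc i y * kc j y) * κ d y) c d) a b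
      = (∑ i, ∑ j, invG G i j y * τ a b i y * τ j c d y)
        + 4 / (n : ℝ) * skew₂ (fun a b ↦ skew₂ (fun c d ↦
            (∑ i, ∑ j, ∑ p, ∑ q, invG G i p y * invG G j q y * τ a p q y * τ d i j y)
              * G b c y) c d) a b := by
  intro kc κ τ
  have hk1 : DifferentiableAt ℝ k y := hk.contDiff.differentiableAt (by norm_num)
  have hI := isInverseForm_invG h.symm.self_of_nhds h.det_ne_zero.self_of_nhds
  obtain ⟨μ, hFk, hperp⟩ := tidalForm_perp h hk hn
  have h0 := hk.null.self_of_nhds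
  have hF := skewForm_skew (formOf G y) (nablaVec (chrisMap G) k y)
  have hτ : ∀ a b c, τ a b c y = wedgeForm (formOf G y)
      (skewForm (formOf G y) (nablaVec (chrisMap G) k y)) (k y) a b c := twist_lower h hk1
  have hκ : ∀ a, κ a y = formOf G y (k y) (stdVec a) := fun a ↦ by
    rw [hI.symm]; exact lower_eq G k a y
  simp only [hτ]
  rw [hI.sum_wedge_wedge hF hFk h0]
  simp only [hI.sum_wedge_sq hF hFk h0]
  -- For a bilinear form S, 4 κ_[a S_{b][c} κ_{d]} is S evaluated on κ_a e_b - κ_b e_a and κ_d e_c -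
  -- κ_c e_d; hence the order d, c in the second vector.
  have key := hperp _ _ (perpVec_orthogonal (g := formOf G y) (k y) a b)
    (perpVec_orthogonal (g := formOf G y) (k y) d c)
  -- the Weyl tensor contracted with `k`
  obtain ⟨P, P', hW⟩ : ∃ P P' : Fin (n + 2) → ℝ, ∀ b c,
      ∑ i, ∑ j, weyl G b i j c y * kc i y * kc j y
        = tidalForm (formOf G y) (chrisMap G) y (k y) (stdVec b) (stdVec c)
          + (∑ i, ∑ j, ricci G i j y * k y i * k y j) / n * formOf G y (stdVec b) (stdVec c)
          - κ b y * P c - κ c y * P' b := by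
    have hκs : ∀ b, ∑ j, G b j y * k y j = κ b y := fun b ↦ rfl
    have hkk : ∑ i, ∑ j, G i j y * k y i * k y j = 0 := by
      rw [← h0, bilin_apply_eq_sum]
      simp only [formOf_stdVec, smul_eq_mul]
      exact Finset.sum_congr rfl fun i _ ↦ Finset.sum_congr rfl fun j _ ↦ by ring
    -- The scalar curvature multiplies g(k, k) = 0 and disappears.
    have hPkk : ∑ i, ∑ j, schouten G j i y * k y i * k y j
        = (∑ i, ∑ j, ricci G i j y * k y i * k y j) / n := by
      have e : ∀ i j, schouten G j i y * k y i * k y j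
          = (ricci G j i y * k y j * k y i) / n
            - scalarCurv G y / (2 * ((n : ℝ) + 1)) / n * (G j i y * k y j * k y i) := by
        intro i j; simp only [schouten]; ring
      simp_rw [e, Finset.sum_sub_distrib, ← Finset.mul_sum, ← Finset.sum_div]
      rw [Finset.sum_comm (f := fun i j ↦ G j i y * _ * _), hkk, Finset.sum_comm]
      ring
    refine ⟨fun c ↦ ∑ i, schouten G c i y * k y i, fun b ↦ ∑ j, schouten G j b y * k y j,
      fun b c ↦ ?_⟩
    have e : ∀ i j, weyl G b i j c y * kc i y * kc j y
        = riemannLow G b i j c y * k y i * k y j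
          - (G b j y * k y j) * (schouten G c i y * k y i)
          + G b c y * (schouten G j i y * k y i * k y j)
          + schouten G c b y * (G i j y * k y i * k y j)
          - (G c i y * k y i) * (schouten G j b y * k y j) := by
      intro i j
      simp only [weyl, skew₂, kc]
      rw [h.symm.self_of_nhds i c]
      ring
    simp_rw [e, Finset.sum_sub_distrib, Finset.sum_add_distrib, Finset.sum_sub_distrib,
      ← Finset.mul_sum, ← Finset.sum_mul, hPkk, hkk, hκs]
    rw [← Finset.mul_sum, sum_riemannLow h, formOf_stdVec]
    ring
  -- The terms with P and P' carry a factor κ_b or κ_c, so skewing with κ cancels them and only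
  -- `key` remains.
  simp only [skew₂, hW, hκ]
  simp only [← formOf_stdVec G y]
  simp only [perpVec, map_sub, map_smul, _root_.sub_apply, _root_.smul_apply, smul_eq_mul]
    at key ⊢
  linear_combination key

end CoordinateIdentity

/-! ### Vector fields and metrics read in a chart. -/

section Chart

open VectorField

variable {n : ℕ} {M : Type*} [TopologicalSpace M] [ChartedSpace (Model n) M]
  [IsManifold (𝓡 (n + 2)) ∞ M] {e : OpenPartialHomeomorph M (Model n)}

theorem mdifferentiable_of_mem_maximalAtlas
    (he : e ∈ IsManifold.maximalAtlas (𝓡 (n + 2)) ∞ M) :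
    e.MDifferentiable (𝓡 (n + 2)) (𝓡 (n + 2)) :=
  ⟨(contMDiffOn_of_mem_maximalAtlas he).mdifferentiableOn (by simp),
    (contMDiffOn_symm_of_mem_maximalAtlas he).mdifferentiableOn (by simp)⟩

/-- The vector field on `M` whose components in the chart `e` are `v`. -/
def chartField (e : OpenPartialHomeomorph M (Model n)) (v : Model n → Model n) : VField n M :=
  mpullback (𝓡 (n + 2)) (𝓡 (n + 2)) e (fun z ↦ (v z : TangentSpace (𝓡 (n + 2)) z))

/-- The vector field `k` read in the chart `e`. -/
def chartVec (k : VField n M) (e : OpenPartialHomeomorph M (Model n)) (z : Model n) : Model n :=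
  mfderiv (𝓡 (n + 2)) (𝓡 (n + 2)) e (e.symm z) (k (e.symm z))

/-- The derivative of the inverse chart. -/
def chartFrame (e : OpenPartialHomeomorph M (Model n)) (z : Model n) :
    Model n →L[ℝ] TangentSpace (𝓡 (n + 2)) (e.symm z) :=
  mfderiv (𝓡 (n + 2)) (𝓡 (n + 2)) e.symm z

theorem isInvertible_mfderiv_chart (he : e ∈ IsManifold.maximalAtlas (𝓡 (n + 2)) ∞ M) {x : M}
    (hx : x ∈ e.source) : (mfderiv (𝓡 (n + 2)) (𝓡 (n + 2)) e x).IsInvertible :=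
  ⟨(mdifferentiable_of_mem_maximalAtlas he).mfderiv hx, rfl⟩

theorem isInvertible_mfderiv_chart_symm (he : e ∈ IsManifold.maximalAtlas (𝓡 (n + 2)) ∞ M)
    {z : Model n} (hz : z ∈ e.target) :
    (mfderiv (𝓡 (n + 2)) (𝓡 (n + 2)) e.symm z).IsInvertible :=
  ⟨(mdifferentiable_of_mem_maximalAtlas he).symm.mfderiv hz, rfl⟩

theorem chartFrame_mfderiv (he : e ∈ IsManifold.maximalAtlas (𝓡 (n + 2)) ∞ M)
    {z : Model n} (hz : z ∈ e.target) (u : TangentSpace (𝓡 (n + 2)) (e.symm z)) :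
    chartFrame e z (mfderiv (𝓡 (n + 2)) (𝓡 (n + 2)) e (e.symm z) u) = u := by
  have h := (mdifferentiable_of_mem_maximalAtlas he).symm_comp_deriv (e.map_target hz)
  rw [e.right_inv hz] at h
  exact congrArg (fun L ↦ L u) h

theorem chartFrame_surjective (he : e ∈ IsManifold.maximalAtlas (𝓡 (n + 2)) ∞ M)
    {z : Model n} (hz : z ∈ e.target) : Function.Surjective (chartFrame e z) :=
  fun u ↦ ⟨_, chartFrame_mfderiv he hz u⟩

theorem chartFrame_chartVec (he : e ∈ IsManifold.maximalAtlas (𝓡 (n + 2)) ∞ M)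
    {z : Model n} (hz : z ∈ e.target) (k : VField n M) :
    chartFrame e z (chartVec k e z) = k (e.symm z) :=
  chartFrame_mfderiv he hz _

theorem mfderiv_chartFrame (he : e ∈ IsManifold.maximalAtlas (𝓡 (n + 2)) ∞ M)
    {z : Model n} (hz : z ∈ e.target) (v : Model n) :
    mfderiv (𝓡 (n + 2)) (𝓡 (n + 2)) e (e.symm z) (chartFrame e z v) = v := by
  have h := (mdifferentiable_of_mem_maximalAtlas he).comp_symm_deriv hz
  exact congrArg (fun L ↦ L v) h

theorem chartFrame_injective (he : e ∈ IsManifold.maximalAtlas (𝓡 (n + 2)) ∞ M)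
    {z : Model n} (hz : z ∈ e.target) : Function.Injective (chartFrame e z) := fun v w h ↦ by
  have h' := congrArg (mfderiv (𝓡 (n + 2)) (𝓡 (n + 2)) e (e.symm z)) h
  rwa [mfderiv_chartFrame he hz, mfderiv_chartFrame he hz] at h'

theorem mpullback_symm_eq (he : e ∈ IsManifold.maximalAtlas (𝓡 (n + 2)) ∞ M)
    {z : Model n} (hz : z ∈ e.target) (k : VField n M) :
    mpullback (𝓡 (n + 2)) (𝓡 (n + 2)) e.symm k z = chartVec k e z := by
  rw [mpullback_apply]
  have h1 := chartFrame_chartVec he hz k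
  rw [← h1]
  exact (isInvertible_mfderiv_chart_symm he hz).inverse_apply_eq.2 rfl

theorem chartField_symm (he : e ∈ IsManifold.maximalAtlas (𝓡 (n + 2)) ∞ M)
    {z : Model n} (hz : z ∈ e.target) (v : Model n → Model n) :
    chartField e v (e.symm z) = chartFrame e z (v z) := by
  change (mfderiv (𝓡 (n + 2)) (𝓡 (n + 2)) e (e.symm z)).inverse (v (e (e.symm z))) = _
  refine (isInvertible_mfderiv_chart he (e.map_target hz)).inverse_apply_eq.2 ?_
  rw [mfderiv_chartFrame he hz, e.right_inv hz]

theorem chartVec_chartField (he : e ∈ IsManifold.maximalAtlas (𝓡 (n + 2)) ∞ M)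
    {z : Model n} (hz : z ∈ e.target) (v : Model n → Model n) :
    chartVec (chartField e v) e z = v z := by
  rw [chartVec, chartField_symm he hz, mfderiv_chartFrame he hz]

theorem contMDiffAt_chartField (he : e ∈ IsManifold.maximalAtlas (𝓡 (n + 2)) ∞ M)
    {x : M} (hx : x ∈ e.source) {v : Model n → Model n} (hv : ContDiffAt ℝ ∞ v (e x)) :
    ContMDiffAt (𝓡 (n + 2)) (𝓡 (n + 2)).tangent ∞
      (fun x ↦ (⟨x, chartField e v x⟩ : TangentBundle (𝓡 (n + 2)) M)) x := by
  have : IsManifold (𝓡 (n + 2)) 1 M := .of_le (n := ∞) (by simp)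
  exact ContMDiffAt.mpullback_vectorField_preimage
    (contMDiffAt_vectorSpace_iff_contDiffAt.2 hv) (contMDiffAt_of_mem_maximalAtlas he hx)
    (isInvertible_mfderiv_chart he hx) (by simp)

theorem contDiffAt_chartVec (he : e ∈ IsManifold.maximalAtlas (𝓡 (n + 2)) ∞ M)
    {z : Model n} (hz : z ∈ e.target) {k : VField n M}
    (hk : ContMDiffAt (𝓡 (n + 2)) (𝓡 (n + 2)).tangent ∞
      (fun x ↦ (⟨x, k x⟩ : TangentBundle (𝓡 (n + 2)) M)) (e.symm z)) :
    ContDiffAt ℝ ∞ (chartVec k e) z := by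
  have : IsManifold (𝓡 (n + 2)) 1 M := .of_le (n := ∞) (by simp)
  have h := ContMDiffAt.mpullback_vectorField_preimage hk
    (contMDiffAt_symm_of_mem_maximalAtlas he hz) (isInvertible_mfderiv_chart_symm he hz)
    (m := ∞) (by simp)
  rw [contMDiffAt_vectorSpace_iff_contDiffAt] at h
  refine h.congr_of_eventuallyEq ?_
  filter_upwards [e.open_target.mem_nhds hz] with w hw using (mpullback_symm_eq he hw k).symm

theorem contMDiffAt_form (g : LorentzMetric n M) {V W : VField n M} {x : M}
    (hV : ContMDiffAt (𝓡 (n + 2)) (𝓡 (n + 2)).tangent ∞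
      (fun x ↦ (⟨x, V x⟩ : TangentBundle (𝓡 (n + 2)) M)) x)
    (hW : ContMDiffAt (𝓡 (n + 2)) (𝓡 (n + 2)).tangent ∞
      (fun x ↦ (⟨x, W x⟩ : TangentBundle (𝓡 (n + 2)) M)) x) :
    ContMDiffAt (𝓡 (n + 2)) 𝓘(ℝ, ℝ) ∞ (fun y ↦ g.form y (V y) (W y)) x := by
  have : ContMDiffAt (𝓡 (n + 2)) ((𝓡 (n + 2)).prod 𝓘(ℝ, ℝ)) ∞
      (fun m ↦ Bundle.TotalSpace.mk' ℝ (E := Bundle.Trivial M ℝ) m (g.form m (V m) (W m))) x := by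
    apply ContMDiffAt.clm_bundle_apply₂ (F₁ := Model n) (F₂ := Model n)
    · exact g.contMDiff x
    · exact hV
    · exact hW
  simp only [Bundle.contMDiffAt_totalSpace] at this
  exact this.2

theorem formOf_metricComp (g : LorentzMetric n M) (e : OpenPartialHomeomorph M (Model n))
    (z v w : Model n) :
    formOf (metricComp g e) z v w = g.form (e.symm z) (chartFrame e z v) (chartFrame e z w) := by
  have h1 : ∀ v, chartFrame e z v = ∑ i, v i • chartFrame e z (stdVec i) := fun v ↦ by
    conv_lhs => rw [eq_sum_stdVec v]
    simp only [map_sum, map_smul]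
  rw [formOf, bilinOf_apply, h1 v, h1 w]
  simp only [map_sum, map_smul, _root_.sum_apply, _root_.smul_apply, smul_eq_mul, Finset.mul_sum]
  rw [Finset.sum_comm]
  refine Finset.sum_congr rfl fun i _ ↦ Finset.sum_congr rfl fun j _ ↦ ?_
  rw [mul_comm (v j), mul_assoc]
  rfl

/-- The component is g paired with two coordinate fields, which are smooth sections near the point,
composed with the inverse chart. -/
theorem contDiffAt_metricComp (g : LorentzMetric n M)
    (he : e ∈ IsManifold.maximalAtlas (𝓡 (n + 2)) ∞ M) {z : Model n} (hz : z ∈ e.target)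
    (a b : Fin (n + 2)) : ContDiffAt ℝ ∞ (metricComp g e a b) z := by
  have hs : ∀ a : Fin (n + 2), ContMDiffAt (𝓡 (n + 2)) (𝓡 (n + 2)).tangent ∞ (fun x ↦
      (⟨x, chartField e (fun _ ↦ stdVec a) x⟩ : TangentBundle (𝓡 (n + 2)) M)) (e.symm z) :=
    fun a ↦ contMDiffAt_chartField he (e.map_target hz) contDiffAt_const
  have h := (contMDiffAt_form g (hs a) (hs b)).comp z (contMDiffAt_symm_of_mem_maximalAtlas he hz)
  rw [contMDiffAt_iff_contDiffAt] at h
  refine h.congr_of_eventuallyEq ?_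
  filter_upwards [e.open_target.mem_nhds hz] with w hw
  simp only [Function.comp_apply]
  rw [chartField_symm he hw, chartField_symm he hw]
  rfl

end Chart

/-! ### Lie brackets and Lie derivatives in a chart. -/

section LieDerivative

open VectorField

variable {n : ℕ} {M : Type*} [TopologicalSpace M] [ChartedSpace (Model n) M]
  [IsManifold (𝓡 (n + 2)) ∞ M] {e : OpenPartialHomeomorph M (Model n)}

theorem two_le_infty : (2 : ℕ∞ω) ≤ ∞ := WithTop.coe_le_coe.2 (le_top : (2 : ℕ∞) ≤ ⊤)

theorem mlieBracket_model (V W : ∀ z : Model n, TangentSpace (𝓡 (n + 2)) z) (z : Model n) :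
    mlieBracket (𝓡 (n + 2)) V W z = lieBracket ℝ V W z := by
  rw [← mlieBracketWithin_univ, mlieBracketWithin_eq_lieBracketWithin]
  exact congrFun (lieBracketWithin_univ (𝕜 := ℝ) (V := (V : Model n → Model n))) z

/-- The bracket is natural under pullback by the inverse chart, and on the model space it is the
difference of directional derivatives. -/
theorem mlieBracket_chart (he : e ∈ IsManifold.maximalAtlas (𝓡 (n + 2)) ∞ M) {z : Model n}
    (hz : z ∈ e.target) {k : VField n M} {v : Model n → Model n}
    (hk : ContMDiffAt (𝓡 (n + 2)) (𝓡 (n + 2)).tangent ∞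
      (fun x ↦ (⟨x, k x⟩ : TangentBundle (𝓡 (n + 2)) M)) (e.symm z))
    (hv : ContDiffAt ℝ ∞ v z) :
    mlieBracket (𝓡 (n + 2)) k (chartField e v) (e.symm z)
      = chartFrame e z (fderiv ℝ v z (chartVec k e z) - fderiv ℝ (chartVec k e) z (v z)) := by
  have : IsManifold (𝓡 (n + 2)) 1 M := .of_le (n := ∞) (by simp)
  have : IsManifold (𝓡 (n + 2)) (minSmoothness ℝ 2) M := .of_le (n := ∞) (by
    rw [minSmoothness_of_isRCLikeNormedField]; exact two_le_infty)
  have hV := contMDiffAt_chartField he (e.map_target hz) (v := v) (by rwa [e.right_inv hz])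
  have h := mpullback_mlieBracket (hk.mdifferentiableAt (by simp)) (hV.mdifferentiableAt (by simp))
    (contMDiffAt_symm_of_mem_maximalAtlas he hz)
    (by rw [minSmoothness_of_isRCLikeNormedField]; exact two_le_infty)
  have e1 : mpullback (𝓡 (n + 2)) (𝓡 (n + 2)) e.symm k =ᶠ[𝓝 z] chartVec k e := by
    filter_upwards [e.open_target.mem_nhds hz] with w hw using mpullback_symm_eq he hw k
  have e2 : mpullback (𝓡 (n + 2)) (𝓡 (n + 2)) e.symm (chartField e v) =ᶠ[𝓝 z] v := by
    filter_upwards [e.open_target.mem_nhds hz] with w hw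
    rw [mpullback_symm_eq he hw, chartVec_chartField he hw]
  rw [e1.mlieBracket_vectorField_eq e2, mpullback_symm_eq he hz] at h
  have h' : chartVec (mlieBracket (𝓡 (n + 2)) k (chartField e v)) e z
      = lieBracket ℝ (chartVec k e) v z := h.trans (mlieBracket_model _ _ z)
  rw [← chartFrame_chartVec he hz (mlieBracket (𝓡 (n + 2)) k (chartField e v)), h']
  rfl

/-- The derivatives of v and w coming from the product rule cancel against those in the brackets, so
only the values v z and w z survive: the Lie derivative is tensorial. -/
theorem lieDerivMetric_chart (g : LorentzMetric n M)
    (he : e ∈ IsManifold.maximalAtlas (𝓡 (n + 2)) ∞ M) {z : Model n}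
    (hz : z ∈ e.target) {k : VField n M} {v w : Model n → Model n}
    (hk : ContMDiffAt (𝓡 (n + 2)) (𝓡 (n + 2)).tangent ∞
      (fun x ↦ (⟨x, k x⟩ : TangentBundle (𝓡 (n + 2)) M)) (e.symm z))
    (hv : ContDiffAt ℝ ∞ v z) (hw : ContDiffAt ℝ ∞ w z) :
    lieDerivMetric g k (chartField e v) (chartField e w) (e.symm z)
      = fderiv ℝ (formOf (metricComp g e)) z (chartVec k e z) (v z) (w z)
        + formOf (metricComp g e) z (fderiv ℝ (chartVec k e) z (v z)) (w z)
        + formOf (metricComp g e) z (v z) (fderiv ℝ (chartVec k e) z (w z)) := by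
  have hg : DifferentiableAt ℝ (formOf (metricComp g e)) z :=
    (contDiffAt_bilinOf (m := ∞) fun a b ↦ contDiffAt_metricComp g he hz a b).differentiableAt
      (by simp)
  have hV := contMDiffAt_chartField he (e.map_target hz) (v := v) (by rwa [e.right_inv hz])
  have hW := contMDiffAt_chartField he (e.map_target hz) (v := w) (by rwa [e.right_inv hz])
  have hf := (contMDiffAt_form g hV hW).mdifferentiableAt (by simp)
  have hes := (contMDiffAt_symm_of_mem_maximalAtlas he hz).mdifferentiableAt (by simp)
  have e1 : (fun y ↦ g.form y (chartField e v y) (chartField e w y)) ∘ e.symm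
      =ᶠ[𝓝 z] fun z ↦ formOf (metricComp g e) z (v z) (w z) := by
    filter_upwards [e.open_target.mem_nhds hz] with p hp
    rw [formOf_metricComp, Function.comp_apply, chartField_symm he hp, chartField_symm he hp]
  have e2 : mvfderiv (𝓡 (n + 2)) (fun y ↦ g.form y (chartField e v y) (chartField e w y))
      (e.symm z) (k (e.symm z))
      = fderiv ℝ (fun z ↦ formOf (metricComp g e) z (v z) (w z)) z (chartVec k e z) := by
    rw [← e1.fderiv_eq, ← mfderiv_eq_fderiv, mfderiv_comp z hf hes,
      ← chartFrame_chartVec he hz k]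
    rfl
  rw [lieDerivMetric, e2, mlieBracket_chart he hz hk hv, mlieBracket_chart he hz hk hw,
    chartField_symm he hz, chartField_symm he hz, ← formOf_metricComp, ← formOf_metricComp,
    fderiv_bilin_apply hg (hv.differentiableAt (by simp)) (hw.differentiableAt (by simp))]
  simp only [map_sub, _root_.sub_apply]
  ring

end LieDerivative

/-! ### Optical vector fields in a chart. -/

section Optical

variable {n : ℕ} {M : Type*} [TopologicalSpace M] [ChartedSpace (Model n) M]
  [IsManifold (𝓡 (n + 2)) ∞ M] {e : OpenPartialHomeomorph M (Model n)}

theorem LorentzMetric.nondegenerate (g : LorentzMetric n M) (x : M)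
    (p : TangentSpace (𝓡 (n + 2)) x) (hp : ∀ v, g.form x v p = 0) : p = 0 := by
  obtain ⟨t, -, ht⟩ := g.signature x
  by_contra h
  exact (ht p (hp t) h).ne' (hp p)

theorem isMetricAt_metricComp (g : LorentzMetric n M)
    (he : e ∈ IsManifold.maximalAtlas (𝓡 (n + 2)) ∞ M) {y : Model n} (hy : y ∈ e.target) :
    IsMetricAt (metricComp g e) y where
  contDiff := contDiffAt_metricComp g he hy
  symm := .of_forall fun z a b ↦ g.symm _ _ _
  det_ne_zero := by
    filter_upwards [e.open_target.mem_nhds hy] with z hz hdet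
    obtain ⟨v, hv, hv0⟩ := Matrix.exists_mulVec_eq_zero_iff.2 hdet
    have h1 : ∀ u, formOf (metricComp g e) z u (WithLp.toLp 2 v) = 0 := by
      intro u
      rw [clm_apply_eq_sum (formOf (metricComp g e) z), _root_.sum_apply]
      refine Finset.sum_eq_zero fun a _ ↦ ?_
      rw [_root_.smul_apply, clm_apply_eq_sum]
      have h0 : ∑ b, v b * metricComp g e a b z = 0 :=
        (Finset.sum_congr rfl fun b _ ↦ mul_comm _ _).trans (congrFun hv0 a)
      simp only [formOf_stdVec, smul_eq_mul, h0, mul_zero]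
    -- A kernel vector of the component matrix is carried by the frame to a vector orthogonal to the
    -- whole tangent space.
    have h2 : chartFrame e z (WithLp.toLp 2 v) = 0 := by
      refine g.nondegenerate _ _ fun u ↦ ?_
      obtain ⟨w, rfl⟩ := chartFrame_surjective he hz u
      rw [← formOf_metricComp, h1]
    have h5 := chartFrame_injective he hz (h2.trans (map_zero _).symm)
    exact hv (congrArg WithLp.ofLp h5)

theorem contDiffAt_perpProj {E : Type*} [NormedAddCommGroup E] [NormedSpace ℝ E]
    {g : E → E →L[ℝ] E →L[ℝ] ℝ} {k : E → E} {y t : E} (hg : ContDiffAt ℝ ∞ g y)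
    (hk : ContDiffAt ℝ ∞ k y) (ht : g y (k y) t ≠ 0) (v : E) :
    ContDiffAt ℝ ∞ (perpProj g k t v) y := by
  have h : ∀ x, ContDiffAt ℝ ∞ (fun z ↦ g z (k z) x) y := fun x ↦
    (hg.clm_apply hk).clm_apply contDiffAt_const
  exact contDiffAt_const.sub (((h v).div (h t) ht).smul contDiffAt_const)

variable {O : OpticalGeometry n M} {U : Set M} {k : VField n M} {g : LorentzMetric n M}

theorem OpticalGeometry.IsOptical.contMDiffAt (hk : O.IsOptical U k) {x : M} (hx : x ∈ U) :
    ContMDiffAt (𝓡 (n + 2)) (𝓡 (n + 2)).tangent ∞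
      (fun x ↦ (⟨x, k x⟩ : TangentBundle (𝓡 (n + 2)) M)) x :=
  hk.smooth.contMDiffAt (hk.isOpen.mem_nhds hx)

theorem OpticalGeometry.IsOptical.mono (hk : O.IsOptical U k) {U' : Set M} (hU' : IsOpen U')
    (h : U' ⊆ U) : O.IsOptical U' k :=
  ⟨hU', ContMDiffOn.mono hk.smooth h, fun x hx ↦ hk.mem x (h hx), fun x hx ↦ hk.ne_zero x (h hx)⟩

theorem OpticalGeometry.IsOptical.exists_eq_smul (hk : O.IsOptical U k) {x : M} (hx : x ∈ U)
    {u : TangentSpace (𝓡 (n + 2)) x} (hu : u ∈ O.K x) : ∃ c : ℝ, u = c • k x := by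
  have h0 : (⟨k x, hk.mem x hx⟩ : O.K x) ≠ 0 := fun h ↦ hk.ne_zero x hx (congrArg Subtype.val h)
  obtain ⟨c, hc⟩ := (finrank_eq_one_iff_of_nonzero' _ h0).1 (O.rank_one x) ⟨u, hu⟩
  exact ⟨c, (congrArg Subtype.val hc).symm⟩

theorem OpticalGeometry.IsOptical.shear_chart (hk : O.IsOptical U k) (hshear : O.IsNonShearing)
    (hg : g ∈ O.c.metrics) (he : e ∈ IsManifold.maximalAtlas (𝓡 (n + 2)) ∞ M) {z t : Model n}
    (hz : z ∈ e.target) (hzU : e.symm z ∈ U)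
    (ht : formOf (metricComp g e) z (chartVec k e z) t ≠ 0) :
    ∃ ρ : ℝ, ∀ v w, formOf (metricComp g e) z (chartVec k e z) v = 0 →
      formOf (metricComp g e) z (chartVec k e z) w = 0 →
      fderiv ℝ (formOf (metricComp g e)) z (chartVec k e z) v w
        + formOf (metricComp g e) z (fderiv ℝ (chartVec k e) z v) w
        + formOf (metricComp g e) z v (fderiv ℝ (chartVec k e) z w)
      = 2 * ρ * formOf (metricComp g e) z v w := by
  have hgs : ∀ {p}, p ∈ e.target → ContDiffAt ℝ ∞ (formOf (metricComp g e)) p := fun hp ↦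
    contDiffAt_formOf (isMetricAt_metricComp g he hp)
  have hks : ∀ {x}, x ∈ U → x ∈ e.source → ContDiffAt ℝ ∞ (chartVec k e) (e x) := fun hx hxe ↦
    contDiffAt_chartVec he (e.map_source hxe) (by
      rw [e.left_inv hxe]; exact hk.contMDiffAt hx)
  -- a neighbourhood on which `t` is transverse to `k^⊥`
  set s : M → ℝ := fun x ↦ formOf (metricComp g e) (e x) (chartVec k e (e x)) t with hs
  have hscont : ContinuousOn s (U ∩ e.source) := by
    rintro x ⟨hx, hxe⟩
    refine ContinuousAt.continuousWithinAt ?_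
    exact ContinuousAt.comp (g := fun p ↦ formOf (metricComp g e) p (chartVec k e p) t)
      (((hgs (e.map_source hxe)).clm_apply (hks hx hxe)).clm_apply
        contDiffAt_const).continuousAt (e.continuousAt hxe)
  -- The non-shearing hypothesis only tests sections of K^⊥ over the open set where k is given. Here
  -- k is restricted to a set on which projecting constant fields along t is smooth throughout.
  set U' := (U ∩ e.source) ∩ s ⁻¹' {0}ᶜ with hU'
  have hU'o : IsOpen U' :=
    hscont.isOpen_inter_preimage (hk.isOpen.inter e.open_source) isOpen_compl_singleton
  have hk' : O.IsOptical U' k := hk.mono hU'o fun x hx ↦ hx.1.1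
  have hzU' : e.symm z ∈ U' := by
    refine ⟨⟨hzU, e.map_target hz⟩, ?_⟩
    simp only [hs, Set.mem_preimage, Set.mem_compl_iff, Set.mem_singleton_iff, e.right_inv hz]
    exact ht
  have hsm : ∀ {x}, x ∈ U' → ∀ v, ContDiffAt ℝ ∞
      (perpProj (formOf (metricComp g e)) (chartVec k e) t v) (e x) := fun hx v ↦
    contDiffAt_perpProj (hgs (e.map_source hx.1.2)) (hks hx.1.1 hx.1.2) hx.2 v
  have hperp : ∀ v, O.IsPerpSection g U'
      (chartField e (perpProj (formOf (metricComp g e)) (chartVec k e) t v)) := by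
    intro v
    refine ⟨fun x hx ↦ (contMDiffAt_chartField he hx.1.2 (hsm hx v)).contMDiffWithinAt,
      fun x hx u hu ↦ ?_⟩
    obtain ⟨c, rfl⟩ := hk'.exists_eq_smul hx hu
    obtain ⟨p, hp, rfl⟩ : ∃ p ∈ e.target, x = e.symm p :=
      ⟨e x, e.map_source hx.1.2, (e.left_inv hx.1.2).symm⟩
    have hpt : formOf (metricComp g e) p (chartVec k e p) t ≠ 0 := by
      have := hx.2
      simpa only [hs, Set.mem_preimage, Set.mem_compl_iff, Set.mem_singleton_iff,
        e.right_inv hp] using this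
    rw [chartField_symm he hp, ← chartFrame_chartVec he hp k, map_smul, _root_.smul_apply,
      ← formOf_metricComp, perpProj_orthogonal hpt, smul_zero]
  -- This ρ is chosen before the sections, so a single value serves all v and w.
  obtain ⟨ρ, hρ⟩ := hshear g hg U' k hk' _ hzU'
  refine ⟨ρ, fun v w hv hw ↦ ?_⟩
  have h := hρ _ _ (hperp v) (hperp w)
  have hsm' := hsm hzU'
  rw [e.right_inv hz] at hsm'
  rw [lieDerivMetric_chart g he hz (hk.contMDiffAt hzU) (hsm' v) (hsm' w),
    chartField_symm he hz, chartField_symm he hz, ← formOf_metricComp, perpProj_eq_self hv,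
    perpProj_eq_self hw] at h
  linarith

theorem OpticalGeometry.IsOptical.exists_transverse (hk : O.IsOptical U k)
    (he : e ∈ IsManifold.maximalAtlas (𝓡 (n + 2)) ∞ M) {z : Model n}
    (hz : z ∈ e.target) (hzU : e.symm z ∈ U) :
    ∃ t, formOf (metricComp g e) z (chartVec k e z) t ≠ 0 := by
  by_contra! h
  have hI := isMetricAt_metricComp g he hz
  have h0 := formOf_nondegenerate
    (isInverseForm_invG hI.symm.self_of_nhds hI.det_ne_zero.self_of_nhds) _ h
  refine hk.ne_zero _ hzU ?_
  rw [← chartFrame_chartVec he hz k, h0, map_zero]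

theorem LorentzMetric.exists_spacelike (g : LorentzMetric n M) (hn : n ≠ 0)
    (he : e ∈ IsManifold.maximalAtlas (𝓡 (n + 2)) ∞ M) {z : Model n} (hz : z ∈ e.target)
    (p : Model n) : ∃ v, formOf (metricComp g e) z p v = 0 ∧ formOf (metricComp g e) z v v ≠ 0 := by
  obtain ⟨t, -, ht⟩ := g.signature (e.symm z)
  obtain ⟨t', rfl⟩ := chartFrame_surjective he hz t
  -- Two linear conditions in dimension n + 2 > 2 leave a nonzero vector orthogonal to p and to a
  -- timelike vector, on which the signature makes g positive.
  let L : Model n →ₗ[ℝ] ℝ × ℝ := (formOf (metricComp g e) z p).toLinearMap.prod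
    (formOf (metricComp g e) z t').toLinearMap
  have hlt : Module.finrank ℝ (ℝ × ℝ) < Module.finrank ℝ (Model n) := by
    rw [Module.finrank_prod, finrank_euclideanSpace_fin, Module.finrank_self]
    omega
  obtain ⟨v, hv, hv0⟩ := (Submodule.ne_bot_iff _).1 (LinearMap.ker_ne_bot_of_finrank_lt hlt (f := L))
  have h1 : formOf (metricComp g e) z p v = 0 := congrArg Prod.fst (LinearMap.mem_ker.1 hv)
  have h2 : formOf (metricComp g e) z t' v = 0 := congrArg Prod.snd (LinearMap.mem_ker.1 hv)
  refine ⟨v, h1, ?_⟩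
  rw [formOf_metricComp] at h2
  rw [formOf_metricComp]
  refine (ht _ h2 fun h ↦ hv0 ?_).ne'
  exact chartFrame_injective he hz (h.trans (map_zero _).symm)

theorem OpticalGeometry.IsOptical.isShearFree (hk : O.IsOptical U k) (hn : n ≠ 0)
    (hshear : O.IsNonShearing)
    (hg : g ∈ O.c.metrics) (he : e ∈ IsManifold.maximalAtlas (𝓡 (n + 2)) ∞ M) {y : Model n}
    (hy : y ∈ e.target) (hyU : e.symm y ∈ U) :
    IsShearFree (formOf (metricComp g e)) (chartVec k e) y := by
  have hM := isMetricAt_metricComp g he hy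
  have hev : ∀ᶠ z in 𝓝 y, z ∈ e.target ∧ e.symm z ∈ U :=
    (e.open_target.eventually_mem hy).and
      ((e.continuousAt_symm hy).eventually (hk.isOpen.mem_nhds hyU))
  refine ⟨contDiffAt_infty.1 (contDiffAt_chartVec he hy (hk.contMDiffAt hyU)) 2, ?_,
    hk.exists_transverse he hy hyU, g.exists_spacelike hn he hy _, ?_, ?_⟩
  · filter_upwards [hev] with z hz
    rw [formOf_metricComp, chartFrame_chartVec he hz.1]
    exact O.null g hg _ _ (hk.mem _ hz.2)
  · filter_upwards [hM.symm, hM.det_ne_zero] with z h1 h2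
    exact formOf_nondegenerate (isInverseForm_invG h1 h2)
  · filter_upwards [hev] with z hz
    obtain ⟨t, ht⟩ := hk.exists_transverse (g := g) he hz.1 hz.2
    exact hk.shear_chart hshear hg he hz.1 hz.2 ht

end Optical

end OpticalGeom

end

theorem mainTheorem9 (n : ℕ) (hn : 2 < n) (M : Type*) [TopologicalSpace M]
    [ChartedSpace (OpticalGeom.Model n) M] [IsManifold (𝓡 (n + 2)) ∞ M]
    (O : OpticalGeom.OpticalGeometry n M) (hgeod : O.IsGeodesic) (hshear : O.IsNonShearing)
    (U : Set M) (k : OpticalGeom.VField n M) (hk : O.IsOptical U k)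
    (g : OpticalGeom.LorentzMetric n M) (hg : g ∈ O.c.metrics)
    (e : OpenPartialHomeomorph M (OpticalGeom.Model n))
    (he : e ∈ IsManifold.maximalAtlas (𝓡 (n + 2)) ∞ M)
    (x : M) (hxU : x ∈ U) (hxe : x ∈ e.source) (a b c d : Fin (n + 2)) :
    let G := OpticalGeom.metricComp g e
    let kc := OpticalGeom.vecComp k e
    let κ := OpticalGeom.lower G kc
    let τ := OpticalGeom.twist G κ
    let W := OpticalGeom.weyl G
    let gi := OpticalGeom.invG G
    let y := e x
    4 * OpticalGeom.skew₂ (fun a b ↦ OpticalGeom.skew₂ (fun c d ↦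
        κ a y * (∑ i, ∑ j, W b i j c y * kc i y * kc j y) * κ d y) c d) a b
      = (∑ i, ∑ j, gi i j y * τ a b i y * τ j c d y)
        + 4 / (n : ℝ) * OpticalGeom.skew₂ (fun a b ↦ OpticalGeom.skew₂ (fun c d ↦
            (∑ i, ∑ j, ∑ p, ∑ q, gi i p y * gi j q y * τ a p q y * τ d i j y) * G b c y)
              c d) a b := by
  -- `hgeod` is not needed: `K` is null and lies in `K^⊥`, so a non-shearing `K` is geodesic
  -- (`OpticalGeom.nablaVec_self`).
  have hy := e.map_source hxe
  have hM := OpticalGeom.isMetricAt_metricComp g he hy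
  have hS := hk.isShearFree (y := e x) (by omega) hshear hg he hy (by rwa [e.left_inv hxe])
  exact OpticalGeom.weyl_identity hM hS (by omega) a b c d
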